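/- Let $A$ be an infinite group and $B$ a group with more than one element, and let $G=A\wr B=A\ltimes\bigoplus_{A}B$ be their (restricted) wreath product: its elements are the pairs $(a,f)$ with $a\in A$ and $f\colon A\to B$ of finite support, and $A$ acts on $\bigoplus_A B$ by shifts. Suppose that $G$ is finitely generated, and equip it with the word metric $d(g,h)=|g^{-1}h|_S$ of an arbitrary finite generating set $S$. For a metric space $M$ with at least two points, a total order $T$ on $M$ and a finite set $X=\{x_1<_T\dots<_T x_n\}\subset M$, let $l_T(X)=\sum_{i=1}^{n-1}d(x_i,x_{i+1})$, and let $l_{\rm opt}(X)$ be the minimal length $\sum_i d(y_i,y_{i+1})$ of a finite sequence $(y_i)$ of points of $M$ that visits all points of $X$. Put $$\operatorname{OR}_{M,T}(k)=\sup_{X\subset M,\ 2\le \#X\le k+1}\frac{l_T(X)}{l_{\rm opt}(X)}\quad(k\ge 1),\qquad \operatorname{OR}_M(k)=\inf_T \operatorname{OR}_{M,T}(k),$$ and let the order breakpoint $\operatorname{Br}(M,T)$ be the smallest integer $s\ge 1$ with $\operatorname{OR}_{M,T}(s)<s$, and $\infty$ if there is no such $s$. The space $M$ has finite Assouad-Nagata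 dimension if there are $m\in\mathbb{N}$ and $K>0$ such that for every $r>0$ the space $M$ is covered by a family $U_r$ of subsets of diameter at most $Kr$ such that every ball of radius at most $r$ is contained in some member of $U_r$ and every point of $M$ belongs to at most $m+1$ members of $U_r$. Then exactly one of the following two alternatives holds: 1. there are a total order $T$ on $G$ and $C>0$ such that $\operatorname{OR}_{G,T}(k)\le C\ln k$ for all $k\ge 2$; 2. $\operatorname{Br}(G,T)=\infty$ for every total order $T$ on $G$. The first alternative holds if and only if $G$ has finite Assouad-Nagata dimension, and this is also equivalent to the existence of $C>0$ with $\operatorname{OR}_{G}(k)\le C\ln k$ for all $k\ge 2$. In the second alternative the order ratio functions are linear: $\operatorname{OR}_{G,T}(k)=k$ for every total order $T$ on $G$ and all $k\ge 1$, and hence $\operatorname{OR}_G(k)=k$ for all $k\ge1$. -/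

import Mathlib

open Set

noncomputable section

/-! ### Order ratio function and order breakpoint -/

/-- Length of the path visiting the points of a list in the given order. -/
def pathLength {M : Type*} [MetricSpace M] : List M → ℝ
  | [] => 0
  | [_] => 0
  | x :: y :: l => dist x y + pathLength (y :: l)

/-- `l_T(X)`: length of the path visiting the points of `X` in increasing order for `T`. -/
def orderLength {M : Type*} [MetricSpace M] (T : LinearOrder M) (X : Finset M) : ℝ :=
  letI := T
  pathLength (X.sort (fun a b => a ≤ b))

/-- `l_opt(X)`: the minimal length of a path in `M` which visits all points of `X`. -/
def optLength {M : Type*} [MetricSpace M] (X : Finset M) : ℝ :=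
  sInf {t : ℝ | ∃ l : List M, (∀ x ∈ X, x ∈ l) ∧ t = pathLength l}

/-- `OR_{M,T}(k)`, the order ratio function of the metric space `M` with the total order `T`
(for `k ≥ 1`; equal to `1` for a one-point space). -/
def orderRatio {M : Type*} [MetricSpace M] (T : LinearOrder M) (k : ℕ) : ℝ :=
  open scoped Classical in
  if Subsingleton M then 1
  else sSup {t : ℝ | ∃ X : Finset M, 2 ≤ X.card ∧ X.card ≤ k + 1 ∧
    t = orderLength T X / optLength X}

/-- `OR_M(k)`, the infimum of `OR_{M,T}(k)` over all total orders `T` on `M`. -/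
def spaceOrderRatio (M : Type*) [MetricSpace M] (k : ℕ) : ℝ :=
  ⨅ T : LinearOrder M, orderRatio T k

/-- `Br(M,T)`, the smallest integer `s ≥ 1` with `OR_{M,T}(s) < s`, and `∞` if there is none
(equal to `1` for a one-point space). -/
def orderBreakpoint {M : Type*} [MetricSpace M] (T : LinearOrder M) : ℕ∞ :=
  open scoped Classical in
  if Subsingleton M then 1
  else sInf {s : ℕ∞ | ∃ n : ℕ, s = n ∧ 1 ≤ n ∧ orderRatio T n < n}

/-! ### Assouad-Nagata dimension -/

/-- The Assouad-Nagata dimension of `M` is at most `m`. -/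
def ANDimLE (M : Type*) [MetricSpace M] (m : ℕ) : Prop :=
  ∃ K : ℝ, 0 < K ∧ ∀ r : ℝ, 0 < r → ∃ U : Set (Set M),
    ⋃₀ U = univ ∧
    (∀ V ∈ U, ∀ x ∈ V, ∀ y ∈ V, dist x y ≤ K * r) ∧
    (∀ x : M, ∀ ρ : ℝ, ρ ≤ r → ∃ V ∈ U, Metric.closedBall x ρ ⊆ V) ∧
    (∀ x : M, {V ∈ U | x ∈ V}.encard ≤ m + 1)

/-- `M` has finite Assouad-Nagata dimension. -/
def FiniteANDim (M : Type*) [MetricSpace M] : Prop :=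
  ∃ m : ℕ, ANDimLE M m

/-! ### Word metrics -/

/-- The word length of `g` with respect to `S`: the least length of a word in the letters
`s` and `s⁻¹`, `s ∈ S`, that represents `g`. -/
def wordLength {G : Type*} [Group G] (S : Set G) (g : G) : ℕ :=
  sInf {n : ℕ | ∃ l : List G, l.length = n ∧ (∀ s ∈ l, s ∈ S ∨ s⁻¹ ∈ S) ∧ l.prod = g}

section WordLength

variable {G : Type*} [Group G] {S : Set G}

theorem wordLength_le (l : List G) (hl : ∀ s ∈ l, s ∈ S ∨ s⁻¹ ∈ S) :
    wordLength S l.prod ≤ l.length :=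
  Nat.sInf_le ⟨l, rfl, hl, rfl⟩

theorem exists_word (hS : Subgroup.closure S = ⊤) (g : G) :
    ∃ l : List G, l.length = wordLength S g ∧ (∀ s ∈ l, s ∈ S ∨ s⁻¹ ∈ S) ∧ l.prod = g := by
  have hg : g ∈ (Subgroup.closure S).toSubmonoid := by rw [hS]; trivial
  rw [Subgroup.closure_toSubmonoid] at hg
  obtain ⟨l, h1, h2⟩ := Submonoid.exists_list_of_mem_closure hg
  exact Nat.sInf_mem (s := {n : ℕ | ∃ l : List G, l.length = n ∧
    (∀ s ∈ l, s ∈ S ∨ s⁻¹ ∈ S) ∧ l.prod = g}) ⟨l.length, l, rfl, h1, h2⟩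

theorem wordLength_one : wordLength S (1 : G) = 0 := by
  simpa using wordLength_le (S := S) [] (by simp)

theorem wordLength_mul_le (hS : Subgroup.closure S = ⊤) (g h : G) :
    wordLength S (g * h) ≤ wordLength S g + wordLength S h := by
  obtain ⟨l, h1, h2, h3⟩ := exists_word hS g
  obtain ⟨l', h1', h2', h3'⟩ := exists_word hS h
  have := wordLength_le (S := S) (l ++ l') (by
    intro s hs
    rcases List.mem_append.1 hs with hs | hs
    · exact h2 s hs
    · exact h2' s hs)
  rwa [List.prod_append, h3, h3', List.length_append, h1, h1'] at this

theorem wordLength_inv_le (hS : Subgroup.closure S = ⊤) (g : G) :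
    wordLength S g⁻¹ ≤ wordLength S g := by
  obtain ⟨l, h1, h2, h3⟩ := exists_word hS g
  have := wordLength_le (S := S) (l.map (fun x => x⁻¹)).reverse (by
    intro s hs
    simp only [List.mem_reverse, List.mem_map] at hs
    obtain ⟨a, ha, rfl⟩ := hs
    simpa using (h2 a ha).symm)
  rwa [← List.prod_inv_reverse, h3, List.length_reverse, List.length_map, h1] at this

theorem eq_one_of_wordLength_eq_zero (hS : Subgroup.closure S = ⊤) {g : G}
    (h : wordLength S g = 0) : g = 1 := by
  obtain ⟨l, h1, -, h3⟩ := exists_word hS g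
  rw [h, List.length_eq_zero_iff] at h1
  rw [← h3, h1, List.prod_nil]

end WordLength

/-- The (left-invariant) word metric `d(g, h) = |g⁻¹ h|_S` on a group generated by `S`. -/
@[reducible] def wordMetricSpace {G : Type*} [Group G] (S : Set G)
    (hS : Subgroup.closure S = ⊤) : MetricSpace G where
  dist g h := (wordLength S (g⁻¹ * h) : ℝ)
  dist_self g := by simp [wordLength_one]
  dist_comm g h := by
    have key : ∀ a b : G, wordLength S (a⁻¹ * b) ≤ wordLength S (b⁻¹ * a) := fun a b => by
      simpa using wordLength_inv_le hS (b⁻¹ * a)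
    exact_mod_cast le_antisymm (key g h) (key h g)
  dist_triangle a b c := by
    have := wordLength_mul_le hS (a⁻¹ * b) (b⁻¹ * c)
    rw [show a⁻¹ * b * (b⁻¹ * c) = a⁻¹ * c by group] at this
    exact_mod_cast this
  eq_of_dist_eq_zero {a b} h :=
    (inv_mul_eq_one.1 (eq_one_of_wordLength_eq_zero hS (by exact_mod_cast h)))

/-! ### Wreath products -/

/-- The (restricted) wreath product `A ≀ B` with base group `A` acting by shifts on `⨁_A B`:
the pairs `(f, a)` with `a : A` and `f : A → B` of finite support. Mathlib's `B ≀ᵣ A` is the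
wreath product with functions `A → B` of arbitrary support. -/
def restrictedWreathProduct (A B : Type*) [Group A] [Group B] : Subgroup (B ≀ᵣ A) where
  carrier := {g | (Function.mulSupport g.left).Finite}
  one_mem' := by simp
  mul_mem' {g h} hg hh := by
    have h2 : (Function.mulSupport fun x => h.left (g.right⁻¹ * x)).Finite :=
      hh.preimage (mul_right_injective g.right⁻¹).injOn
    exact (hg.union h2).subset (Function.mulSupport_mul _ _)
  inv_mem' {g} hg := by
    have h2 : (Function.mulSupport fun x => g.left (g.right * x)).Finite :=
      hg.preimage (mul_right_injective g.right).injOn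
    refine h2.subset fun x hx => ?_
    simpa [Function.mem_mulSupport] using hx

end

/-! ### Snakes in products of copies of `ℕ` -/

/-! Everything depends on whether `B` is finite and `A` has linear growth for the projected
generators. The word metric is that of a lamplighter walking on `A`: a distance is at most a
constant times the cost of the lamp changes plus the length of a walk through the changed lamps
(`exists_wordLength_le_path`). It is at least a multiple of the lamp cost
(`exists_sum_wordLength_left_le`), and a short distance allows only lamps near the lamplighter to
change (`exists_wordLength_le_of_left_ne`).

If the condition holds, a ball of radius `n` in `A` is toured in `O(n)` steps and all its lamps are
reset at cost `O(n)`. Sets with the lamplighter near a net point and the lamps prescribed far from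
that point then form covers of bounded multiplicity at every scale, so the Assouad-Nagata dimension
is finite (`finiteANDim_of_hasLinearGrowth`). Such a space carries nested partitions and a total
order for which all cells are convex. For at most `k + 1` points only about `log k` scales matter,
and each adds `O(l_opt)` to the ordered path (`FiniteANDim.exists_orderRatio_le_log`).

If the condition fails, there are arbitrarily many disjoint blocks of lamps, each of cost `w` to
switch and toured from `1` in `O(w)` steps (`exists_lamp_blocks`). Lighting one block per coordinate
maps cubes `{0, …, n - 1} ^ q` into the group (`hasCubes`): changing one coordinate costs `O(w)`,
changing all of them at least a multiple of `q w`. By a Ramsey-type argument with a nonprincipal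
ultrafilter (`exists_isSnake`), every total order on large cubes contains an increasing chain that
alternates between two such clusters. The ordered path makes `k` long jumps where one suffices, up
to a relative error `O(1 / q)`; letting `q` grow gives order ratio `k`.

A linear function is not bounded by a logarithmic one, so the two cases exclude each other, and all
equivalences follow. -/

theorem exists_strictMono_chain {Q : ℕ → ℕ → Prop}
    (h : ∀ᶠ a in (Filter.hyperfilter ℕ : Filter ℕ), ∀ᶠ b in (Filter.hyperfilter ℕ : Filter ℕ),
      Q a b) :
    ∃ a : ℕ → ℕ, StrictMono a ∧ ∀ i, Q (a i) (a (i + 1)) := by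
  let P : Type := {a : ℕ // ∀ᶠ b in (Filter.hyperfilter ℕ : Filter ℕ), Q a b}
  have gt : ∀ n : ℕ, ∀ᶠ b in (Filter.hyperfilter ℕ : Filter ℕ), n < b := fun n =>
    Nat.hyperfilter_le_atTop (Filter.eventually_gt_atTop n)
  -- The next index has to be larger, related to the current one, and itself related to almost all
  -- indices so that the construction continues; each condition holds for almost all indices.
  have step : ∀ p : P, ∃ p' : P, p.1 < p'.1 ∧ Q p.1 p'.1 := fun p => by
    obtain ⟨b, h1, h2, h3⟩ := ((h.and (p.2.and (gt p.1)))).exists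
    exact ⟨⟨b, h1⟩, h3, h2⟩
  choose nxt hnxt using step
  obtain ⟨a0, ha0⟩ := h.exists
  let sq : ℕ → P := fun n => Nat.rec ⟨a0, ha0⟩ (fun _ p => nxt p) n
  exact ⟨fun n => (sq n).1, strictMono_nat_of_lt_succ fun n => (hnxt (sq n)).1,
    fun n => (hnxt (sq n)).2⟩

/-- Two sequences `f`, `g` with `f ≤ g` termwise either satisfy `f a ≤ g b` for generic distinct
`a`, `b`, or interlace. -/
theorem interlace_of_eventually_le {X : Type*} {R : X → X → Prop} (tot : ∀ x y, R x y ∨ R y x)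
    (trans : ∀ x y z, R x y → R y z → R x z) {f g : ℕ → X}
    (hfg : ∀ᶠ a in (Filter.hyperfilter ℕ : Filter ℕ), R (f a) (g a)) :
    (∀ᶠ a in (Filter.hyperfilter ℕ : Filter ℕ), ∀ᶠ b in (Filter.hyperfilter ℕ : Filter ℕ),
      R (f a) (g b) ∧ R (f b) (g a)) ∨
    (∀ᶠ a in (Filter.hyperfilter ℕ : Filter ℕ), ∀ᶠ b in (Filter.hyperfilter ℕ : Filter ℕ),
      R (f a) (g b) ∧ R (g a) (f b)) ∨
    (∀ᶠ a in (Filter.hyperfilter ℕ : Filter ℕ), ∀ᶠ b in (Filter.hyperfilter ℕ : Filter ℕ),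
      R (g b) (f a) ∧ R (f b) (g a)) := by
  have neg : ∀ {x y}, ¬ R x y → R y x := fun {x y} h => (tot x y).resolve_left h
  by_cases p : ∀ᶠ a in (Filter.hyperfilter ℕ : Filter ℕ),
      ∀ᶠ b in (Filter.hyperfilter ℕ : Filter ℕ), R (f a) (g b)
  · by_cases p' : ∀ᶠ a in (Filter.hyperfilter ℕ : Filter ℕ),
        ∀ᶠ b in (Filter.hyperfilter ℕ : Filter ℕ), R (f b) (g a)
    · left
      filter_upwards [p, p'] with a h1 h2 using h1.and h2
    · right; left
      simp only [← Ultrafilter.eventually_not] at p'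
      filter_upwards [p, p'] with a h1 h2
      filter_upwards [h1, h2] with b h3 h4 using ⟨h3, neg h4⟩
  · simp only [← Ultrafilter.eventually_not] at p
    by_cases p' : ∀ᶠ a in (Filter.hyperfilter ℕ : Filter ℕ),
        ∀ᶠ b in (Filter.hyperfilter ℕ : Filter ℕ), R (f b) (g a)
    · right; right
      filter_upwards [p, p'] with a h1 h2
      filter_upwards [h1, h2] with b h3 h4 using ⟨neg h3, h4⟩
    -- The fourth combination is impossible: `f b ≤ g b ≤ f a ≤ g a` contradicts the second
    -- negation.
    · simp only [← Ultrafilter.eventually_not] at p'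
      obtain ⟨a, h1, h2, h3⟩ := (p.and (p'.and hfg)).exists
      obtain ⟨b, h4, h5, h6⟩ := (h1.and (h2.and hfg)).exists
      exact absurd (trans _ _ _ h6 (trans _ _ _ (neg h4) h3)) h5

/-- A chain `x 0, …, x s` for `R` of vectors whose terms of equal parity differ in at most one
coordinate, while terms of different parity differ in all coordinates. -/
structure IsSnake {q : ℕ} (R : (Fin q → ℕ) → (Fin q → ℕ) → Prop) (s : ℕ)
    (x : ℕ → Fin q → ℕ) : Prop where
  chain : ∀ i < s, R (x i) (x (i + 1))
  near : ∀ i ≤ s, ∀ j ≤ s, (Even i ↔ Even j) → {k | x i k ≠ x j k}.Subsingleton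
  far : ∀ i ≤ s, ∀ j ≤ s, ¬ (Even i ↔ Even j) → ∀ k, x i k ≠ x j k

/-- Terms of equal parity share their tail, hence differ only in the first coordinate. Injectivity
of `a` makes terms of different parity differ there too. -/
theorem isSnake_cons {q : ℕ} {R : (Fin (q + 1) → ℕ) → (Fin (q + 1) → ℕ) → Prop} {s : ℕ}
    {u v : Fin q → ℕ} (huv : ∀ k, u k ≠ v k) {a : ℕ → ℕ}
    (ha : ∀ i ≤ s, ∀ j ≤ s, a i = a j → i = j)
    (h1 : ∀ i < s, Even i → R (Fin.cons (a i) u) (Fin.cons (a (i + 1)) v))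
    (h2 : ∀ i < s, ¬ Even i → R (Fin.cons (a i) v) (Fin.cons (a (i + 1)) u)) :
    IsSnake R s (fun i => Fin.cons (a i) (if Even i then u else v)) where
  chain i hi := by
    by_cases h : Even i
    · simpa [h, Nat.even_add_one] using h1 i hi h
    · simpa [h, Nat.even_add_one] using h2 i hi h
  near i _ j _ h := by
    intro k hk l hl
    have : ∀ k : Fin (q + 1), (Fin.cons (a i) (if Even i then u else v) : Fin (q + 1) → ℕ) k ≠
        (Fin.cons (a j) (if Even j then u else v) : Fin (q + 1) → ℕ) k → k = 0 := by
      intro k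
      refine Fin.cases (fun _ => rfl) (fun k hk => ?_) k
      simp [h] at hk
    rw [this k hk, this l hl]
  far i hi j hj h k := by
    refine Fin.cases ?_ (fun k => ?_) k
    · simp only [Fin.cons_zero]
      intro he
      exact h (by rw [ha i hi j hj he])
    · simp only [Fin.cons_succ]
      by_cases hi' : Even i <;> by_cases hj' : Even j
      · exact absurd (iff_of_true hi' hj') h
      · rw [if_pos hi', if_neg hj']; exact huv k
      · rw [if_neg hi', if_pos hj']; exact (huv k).symm
      · exact absurd (iff_of_false hi' hj') h

/-- Every total preorder on `ℕ ^ q` admits snakes of every length. -/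
theorem exists_isSnake (s q : ℕ) (R : (Fin q → ℕ) → (Fin q → ℕ) → Prop)
    (tot : ∀ x y, R x y ∨ R y x) (trans : ∀ x y z, R x y → R y z → R x z) :
    ∃ x, IsSnake R s x := by
  induction q with
  | zero =>
    refine ⟨fun _ => Fin.elim0, fun _ _ => ?_, fun _ _ _ _ _ k => k.elim0,
      fun _ _ _ _ _ k => k.elim0⟩
    exact (tot _ _).elim id id
  | succ q ih =>
    -- The induction hypothesis is applied to the limit, along the ultrafilter in the first
    -- coordinate, of the preorders on the slices.
    obtain ⟨u, hu⟩ := ih (fun u v => ∀ᶠ a in (Filter.hyperfilter ℕ : Filter ℕ),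
        R (Fin.cons a u) (Fin.cons a v))
      (fun x y => Ultrafilter.eventually_or.1 (Filter.Eventually.of_forall fun a => tot _ _))
      (fun x y z h1 h2 => by filter_upwards [h1, h2] with a h3 h4 using trans _ _ _ h3 h4)
    have key := fun i (hi : i < s) => interlace_of_eventually_le tot trans (hu.chain i hi)
    have hne : ∀ i < s, ∀ k, u i k ≠ u (i + 1) k := fun i hi =>
      hu.far i hi.le (i + 1) hi (by rw [Nat.even_add_one]; tauto)
    -- If every neighbouring pair of `u` stays comparable after independent generic changes of the
    -- first coordinate, two values `a`, `b` used alternately lift the whole snake. Otherwise a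
    -- single interlacing pair `u i`, `u (i + 1)` already yields a snake, with only the first
    -- coordinate moving inside each parity class.
    by_cases hall : ∀ i < s, ∀ᶠ a in (Filter.hyperfilter ℕ : Filter ℕ),
        ∀ᶠ b in (Filter.hyperfilter ℕ : Filter ℕ),
        R (Fin.cons a (u i)) (Fin.cons b (u (i + 1))) ∧ R (Fin.cons b (u i)) (Fin.cons a (u (i + 1)))
    · have h1 : ∀ᶠ a in (Filter.hyperfilter ℕ : Filter ℕ), ∀ i ∈ Finset.range s,
          ∀ᶠ b in (Filter.hyperfilter ℕ : Filter ℕ), R (Fin.cons a (u i)) (Fin.cons b (u (i + 1))) ∧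
            R (Fin.cons b (u i)) (Fin.cons a (u (i + 1))) :=
        (Filter.eventually_all_finset _).2 fun i hi => hall i (Finset.mem_range.1 hi)
      obtain ⟨a, ha⟩ := h1.exists
      have h2 := ((Filter.eventually_all_finset _).2 ha).and
        (Nat.hyperfilter_le_atTop (Filter.eventually_gt_atTop a))
      obtain ⟨b, hb, hab⟩ := h2.exists
      have hab : a < b := hab
      refine ⟨fun i => Fin.cons (if Even i then a else b) (u i), fun i hi => ?_,
        fun i hi j hj h => ?_, fun i hi j hj h k => ?_⟩
      · have := hb i (Finset.mem_range.2 hi)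
        by_cases h : Even i <;> simp [h, Nat.even_add_one, this]
      · have : ∀ k, (Fin.cons (if Even i then a else b) (u i) : Fin (q + 1) → ℕ) k ≠
            (Fin.cons (if Even j then a else b) (u j) : Fin (q + 1) → ℕ) k →
            ∃ k', k = Fin.succ k' ∧ u i k' ≠ u j k' := by
          intro k
          refine Fin.cases (fun hk => ?_) (fun k hk => ⟨k, rfl, by simpa using hk⟩) k
          simp [h] at hk
        intro k hk l hl
        obtain ⟨k', rfl, hk'⟩ := this k hk
        obtain ⟨l', rfl, hl'⟩ := this l hl
        rw [hu.near i hi j hj h hk' hl']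
      · refine Fin.cases ?_ (fun k => ?_) k
        · simp only [Fin.cons_zero]
          by_cases hi' : Even i <;> by_cases hj' : Even j
          · exact absurd (iff_of_true hi' hj') h
          · rw [if_pos hi', if_neg hj']; exact hab.ne
          · rw [if_neg hi', if_pos hj']; exact hab.ne'
          · exact absurd (iff_of_false hi' hj') h
        · simpa using hu.far i hi j hj h k
    · simp only [not_forall] at hall
      obtain ⟨i, hi, hni⟩ := hall
      rcases (key i hi).resolve_left hni with h | h
      · obtain ⟨a, ha, hQ⟩ := exists_strictMono_chain h
        exact ⟨_, isSnake_cons (s := s) (hne i hi) (fun i _ j _ h => ha.injective h)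
          (fun i _ _ => (hQ i).1) (fun i _ _ => (hQ i).2)⟩
      -- The interlacing goes downwards here, so the chain is read backwards from index `s`.
      · obtain ⟨a, ha, hQ⟩ := exists_strictMono_chain h
        refine ⟨_, isSnake_cons (s := s) (a := fun i => a (s - i)) (hne i hi)
          (fun i _ j _ h => ?_) (fun i hi _ => ?_) (fun i hi _ => ?_)⟩
        · have := ha.injective h
          omega
        · have := (hQ (s - (i + 1))).2
          rwa [show s - (i + 1) + 1 = s - i by omega] at this
        · have := (hQ (s - (i + 1))).1
          rwa [show s - (i + 1) + 1 = s - i by omega] at this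

/-! ### Path lengths and the order ratio function -/

section PathLength

variable {M : Type*} [MetricSpace M]

theorem pathLength_cons_cons (x y : M) (l : List M) :
    pathLength (x :: y :: l) = dist x y + pathLength (y :: l) := rfl

theorem pathLength_singleton (x : M) : pathLength [x] = 0 := rfl

theorem pathLength_nonneg (l : List M) : 0 ≤ pathLength l := by
  induction l with
  | nil => exact le_rfl
  | cons x l ih =>
    cases l with
    | nil => exact le_rfl
    | cons y l => exact add_nonneg dist_nonneg ih

theorem pathLength_append_cons (l₁ : List M) (x : M) (l₂ : List M) :
    pathLength (l₁ ++ x :: l₂) = pathLength (l₁ ++ [x]) + pathLength (x :: l₂) := by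
  induction l₁ with
  | nil => simp [pathLength_singleton]
  | cons y l ih =>
    cases l with
    | nil => simp [pathLength_cons_cons, pathLength_singleton]
    | cons z l =>
      simp only [List.cons_append, pathLength_cons_cons] at ih ⊢
      rw [ih]; ring

theorem pathLength_le_cons (x : M) (l : List M) : pathLength l ≤ pathLength (x :: l) := by
  cases l with
  | nil => exact le_rfl
  | cons y l => exact le_add_of_nonneg_left dist_nonneg

theorem dist_head_le_pathLength {x y : M} {l : List M} (h : y ∈ x :: l) :
    dist x y ≤ pathLength (x :: l) := by
  induction l generalizing x with
  | nil => simp_all [pathLength_singleton]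
  | cons z l ih =>
    rcases List.mem_cons.1 h with rfl | h
    · simpa using pathLength_nonneg (y :: z :: l)
    · exact (dist_triangle x z y).trans (add_le_add_right (ih h) _)

theorem dist_le_pathLength {x y : M} {l : List M} (hx : x ∈ l) (hy : y ∈ l) :
    dist x y ≤ pathLength l := by
  induction l with
  | nil => simp at hx
  | cons z l ih =>
    rcases List.mem_cons.1 hx with rfl | hx'
    · exact dist_head_le_pathLength hy
    · rcases List.mem_cons.1 hy with rfl | hy'
      · rw [dist_comm]; exact dist_head_le_pathLength hx
      · exact (ih hx' hy').trans (pathLength_le_cons z l)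

theorem pathLength_le_length_mul {D : ℝ} {l : List M} (h : ∀ x ∈ l, ∀ y ∈ l, dist x y ≤ D) :
    pathLength l ≤ (l.length - 1 : ℕ) * D := by
  induction l with
  | nil => simp [pathLength]
  | cons x l ih =>
    cases l with
    | nil => simp [pathLength]
    | cons y l =>
      have h1 := ih fun a ha b hb => h a (List.mem_cons_of_mem _ ha) b (List.mem_cons_of_mem _ hb)
      have h2 := h x (by simp) y (by simp)
      rw [pathLength_cons_cons]
      simp only [List.length_cons, Nat.add_sub_cancel] at h1 ⊢
      push_cast
      linarith

theorem pathLength_append_le {D : ℝ} {l₁ l₂ : List M} (hD : 0 ≤ D)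
    (h : ∀ x ∈ l₁, ∀ y ∈ l₂, dist x y ≤ D) :
    pathLength (l₁ ++ l₂) ≤ pathLength l₁ + D + pathLength l₂ := by
  induction l₁ with
  | nil => simpa [pathLength] using hD
  | cons x l ih =>
    have ih := ih fun a ha b hb => h a (List.mem_cons_of_mem _ ha) b hb
    cases l with
    | nil =>
      cases l₂ with
      | nil => simpa [pathLength] using hD
      | cons y l₂ =>
        have := h x (by simp) y (by simp)
        simpa [pathLength_cons_cons, pathLength_singleton] using this
    | cons z l =>
      simp only [List.cons_append, pathLength_cons_cons] at ih ⊢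
      linarith

theorem mul_le_pathLength_map_range {D : ℝ} {y : ℕ → M} {k : ℕ}
    (h : ∀ i < k, D ≤ dist (y i) (y (i + 1))) :
    k * D ≤ pathLength ((List.range (k + 1)).map y) := by
  induction k with
  | zero => simp [pathLength]
  | succ k ih =>
    have ih := ih fun i hi => h i (hi.trans (Nat.lt_succ_self k))
    have h1 := h k (Nat.lt_succ_self k)
    rw [List.range_succ, List.map_append, List.range_succ, List.map_append, List.append_assoc]
    rw [List.range_succ, List.map_append] at ih
    simp only [List.map_cons, List.map_nil, List.cons_append, List.nil_append] at ih ⊢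
    rw [pathLength_append_cons, pathLength_cons_cons, pathLength_singleton]
    push_cast
    linarith

theorem optLength_le {X : Finset M} {l : List M} (h : ∀ x ∈ X, x ∈ l) :
    optLength X ≤ pathLength l :=
  csInf_le ⟨0, by rintro t ⟨l, -, rfl⟩; exact pathLength_nonneg l⟩ ⟨l, h, rfl⟩

theorem le_optLength {X : Finset M} {a : ℝ}
    (h : ∀ l : List M, (∀ x ∈ X, x ∈ l) → a ≤ pathLength l) : a ≤ optLength X :=
  le_csInf ⟨_, X.toList, by simp, rfl⟩ (by rintro t ⟨l, hl, rfl⟩; exact h l hl)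

theorem dist_le_optLength {X : Finset M} {x y : M} (hx : x ∈ X) (hy : y ∈ X) :
    dist x y ≤ optLength X :=
  le_optLength fun _ hl => dist_le_pathLength (hl x hx) (hl y hy)

theorem optLength_pos {X : Finset M} (h : 2 ≤ X.card) : 0 < optLength X := by
  obtain ⟨x, hx, y, hy, hxy⟩ := Finset.one_lt_card.1 h
  exact (dist_pos.2 hxy).trans_le (dist_le_optLength hx hy)

theorem orderLength_nonneg (T : LinearOrder M) (X : Finset M) : 0 ≤ orderLength T X :=
  pathLength_nonneg _

theorem orderLength_eq_pathLength (T : LinearOrder M) {X : Finset M} {l : List M}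
    (hl : l.Pairwise T.lt) (hX : ∀ x, x ∈ l ↔ x ∈ X) : orderLength T X = pathLength l := by
  let := T
  have hn : l.Nodup := hl.imp fun h => ne_of_lt h
  have hX' : l.toFinset = X := by ext x; simp [hX]
  have := (List.toFinset_sort (· ≤ ·) hn).2 (hl.imp fun h => le_of_lt h)
  rw [← hX']
  exact congrArg pathLength this

theorem exists_list_orderLength (T : LinearOrder M) (X : Finset M) :
    ∃ l : List M, l.Pairwise T.lt ∧ (∀ x, x ∈ l ↔ x ∈ X) ∧ l.length = X.card ∧
      orderLength T X = pathLength l := by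
  let := T
  exact ⟨X.sort (· ≤ ·), X.sortedLT_sort.pairwise, by simp, by simp, rfl⟩

theorem orderLength_le_mul_optLength (T : LinearOrder M) {X : Finset M} {k : ℕ}
    (hX : X.card ≤ k + 1) : orderLength T X ≤ k * optLength X := by
  obtain ⟨l, -, hmem, hlen, he⟩ := exists_list_orderLength T X
  rw [he]
  refine (pathLength_le_length_mul (D := optLength X) fun x hx y hy =>
    dist_le_optLength ((hmem x).1 hx) ((hmem y).1 hy)).trans ?_
  refine mul_le_mul_of_nonneg_right ?_ (le_optLength fun l _ => pathLength_nonneg l)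
  exact_mod_cast (by omega : l.length - 1 ≤ k)

theorem orderRatio_eq [Nontrivial M] (T : LinearOrder M) (k : ℕ) :
    orderRatio T k = sSup {t : ℝ | ∃ X : Finset M, 2 ≤ X.card ∧ X.card ≤ k + 1 ∧
      t = orderLength T X / optLength X} :=
  if_neg (not_subsingleton M)

theorem div_optLength_le (T : LinearOrder M) {X : Finset M} {k : ℕ} (h2 : 2 ≤ X.card)
    (hX : X.card ≤ k + 1) : orderLength T X / optLength X ≤ k :=
  (div_le_iff₀ (optLength_pos h2)).2 (orderLength_le_mul_optLength T hX)

theorem orderRatio_nonneg (T : LinearOrder M) (k : ℕ) : 0 ≤ orderRatio T k := by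
  rcases subsingleton_or_nontrivial M with h | h
  · simp [orderRatio, h]
  · rw [orderRatio_eq]
    refine Real.sSup_nonneg ?_
    rintro t ⟨X, h2, -, rfl⟩
    exact div_nonneg (orderLength_nonneg T X) (optLength_pos h2).le

theorem orderRatio_le_of_forall [Nontrivial M] (T : LinearOrder M) {k : ℕ} {a : ℝ} (ha : 0 ≤ a)
    (h : ∀ X : Finset M, 2 ≤ X.card → X.card ≤ k + 1 → orderLength T X ≤ a * optLength X) :
    orderRatio T k ≤ a := by
  rw [orderRatio_eq]
  refine Real.sSup_le ?_ ha
  rintro t ⟨X, h2, hk, rfl⟩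
  exact (div_le_iff₀ (optLength_pos h2)).2 (h X h2 hk)

theorem orderRatio_le [Nontrivial M] (T : LinearOrder M) (k : ℕ) : orderRatio T k ≤ k :=
  orderRatio_le_of_forall T (Nat.cast_nonneg k) fun _ _ => orderLength_le_mul_optLength T

theorem orderLength_le_orderRatio_mul [Nontrivial M] (T : LinearOrder M) {X : Finset M} {k : ℕ}
    (h2 : 2 ≤ X.card) (hX : X.card ≤ k + 1) :
    orderLength T X ≤ orderRatio T k * optLength X := by
  rw [← div_le_iff₀ (optLength_pos h2), orderRatio_eq]
  refine le_csSup ⟨k, ?_⟩ ⟨X, h2, hX, rfl⟩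
  rintro t ⟨X, h2, hk, rfl⟩
  exact div_optLength_le T h2 hk

/-- If the points `y 0 <_T … <_T y k` lie alternately in two clusters of diameter at most `δ`
at distance about `D`, then `OR_{M,T}(k)` is at least `k (D - 2 δ) / (D + 2 (k + 2) δ)`. -/
theorem le_orderRatio_of_clusters [Nontrivial M] (T : LinearOrder M) {k : ℕ} (hk : 1 ≤ k)
    {y : ℕ → M} (hy : ∀ i < k, T.lt (y i) (y (i + 1))) {δ : ℝ}
    (hδ : ∀ i ≤ k, ∀ j ≤ k, (Even i ↔ Even j) → dist (y i) (y j) ≤ δ) :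
    k * (dist (y 0) (y 1) - 2 * δ) ≤
      orderRatio T k * (dist (y 0) (y 1) + 2 * (k + 2) * δ) := by
  classical
  have hδ0 : 0 ≤ δ := dist_nonneg.trans (hδ 0 (Nat.zero_le _) 0 (Nat.zero_le _) Iff.rfl)
  set D := dist (y 0) (y 1) with hD
  have hlt : ∀ i j, i < j → j ≤ k → T.lt (y i) (y j) := by
    intro i j hij
    induction j, hij using Nat.le_induction with
    | base => exact fun h => hy i h
    | succ j _ ih =>
      exact fun h => let := T; lt_trans (ih ((Nat.le_succ j).trans h)) (hy j h)
  have hpair : ((List.range (k + 1)).map y).Pairwise T.lt := by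
    rw [List.pairwise_map]
    refine List.Pairwise.imp_of_mem (R := (· < ·)) (fun {a b} _ hb hab => ?_)
      List.pairwise_lt_range
    exact hlt a b hab (Nat.lt_succ_iff.1 (List.mem_range.1 hb))
  have hnd : ((List.range (k + 1)).map y).Nodup :=
    hpair.imp fun {a b} h => let := T; ne_of_lt h
  set X : Finset M := ((List.range (k + 1)).map y).toFinset with hX
  have hcard : X.card = k + 1 := by rw [hX, List.toFinset_card_of_nodup hnd]; simp
  have hord : orderLength T X = pathLength ((List.range (k + 1)).map y) :=
    orderLength_eq_pathLength T hpair fun x => by simp [hX]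
  have hcross : ∀ i ≤ k, ∀ j ≤ k, Even i → ¬ Even j →
      dist (y i) (y j) ≤ D + 2 * δ ∧ D - 2 * δ ≤ dist (y i) (y j) := by
    intro i hi j hj hei hoj
    have h1 := hδ i hi 0 (Nat.zero_le _) (by simp [hei])
    have h2 := hδ j hj 1 hk (by simpa using hoj)
    have t1 := dist_triangle4 (y i) (y 0) (y 1) (y j)
    have t2 := dist_triangle4 (y 0) (y i) (y j) (y 1)
    rw [dist_comm (y 1) (y j)] at t1
    rw [dist_comm (y 0) (y i)] at t2
    constructor <;> linarith
  have hlow : k * (D - 2 * δ) ≤ orderLength T X := by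
    rw [hord]
    refine mul_le_pathLength_map_range fun i hi => ?_
    by_cases he : Even i
    · exact (hcross i hi.le (i + 1) hi he (by rw [Nat.even_add_one]; tauto)).2
    · rw [dist_comm]
      exact (hcross (i + 1) hi i hi.le (by rw [Nat.even_add_one]; tauto) he).2
  have hclus : ∀ p : ℕ → Bool, (∀ i j, p i = true → p j = true → (Even i ↔ Even j)) →
      pathLength (((List.range (k + 1)).filter p).map y) ≤ k * δ := by
    intro p hp
    refine (pathLength_le_length_mul (D := δ) ?_).trans (mul_le_mul_of_nonneg_right ?_ hδ0)
    · simp only [List.mem_map, List.mem_filter, List.mem_range]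
      rintro _ ⟨i, ⟨hi, hpi⟩, rfl⟩ _ ⟨j, ⟨hj, hpj⟩, rfl⟩
      exact hδ i (by omega) j (by omega) (hp i j hpi hpj)
    · have := List.length_filter_le p (List.range (k + 1))
      simp only [List.length_range] at this
      rw [List.length_map]
      exact_mod_cast (by omega)
  -- The competing path visits all even-indexed points and then all odd-indexed ones, crossing
  -- between the clusters once.
  have hopt : optLength X ≤ D + 2 * (k + 2) * δ := by
    refine (optLength_le (l := ((List.range (k + 1)).filter fun i => decide (Even i)).map y ++
      ((List.range (k + 1)).filter fun i => decide (¬ Even i)).map y) ?_).trans ?_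
    · intro x hx
      simp only [hX, List.mem_toFinset, List.mem_map] at hx
      obtain ⟨i, hi, rfl⟩ := hx
      rw [List.mem_append]
      by_cases he : Even i
      · exact Or.inl (List.mem_map_of_mem (List.mem_filter.2 ⟨hi, by simpa using he⟩))
      · exact Or.inr (List.mem_map_of_mem (List.mem_filter.2 ⟨hi, by simpa using he⟩))
    · have h1 := hclus (fun i => decide (Even i)) (by
        intro i j hi hj; simp only [decide_eq_true_eq] at hi hj; tauto)
      have h2 := hclus (fun i => decide (¬ Even i)) (by
        intro i j hi hj; simp only [decide_eq_true_eq] at hi hj; tauto)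
      refine (pathLength_append_le (D := D + 2 * δ) (by positivity) ?_).trans ?_
      · simp only [List.mem_map, List.mem_filter, List.mem_range, decide_eq_true_eq]
        rintro _ ⟨i, ⟨hi, hpi⟩, rfl⟩ _ ⟨j, ⟨hj, hpj⟩, rfl⟩
        exact (hcross i (by omega) j (by omega) hpi hpj).1
      · nlinarith
  calc (k : ℝ) * (D - 2 * δ) ≤ orderLength T X := hlow
    _ ≤ orderRatio T k * optLength X :=
      orderLength_le_orderRatio_mul T (by omega) hcard.le
    _ ≤ _ := mul_le_mul_of_nonneg_left hopt (orderRatio_nonneg T k)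

/-- `M` contains, for some `C` and all `q` and `n`, images of the cube `{0, …, n - 1} ^ q` such
that changing one coordinate moves a point by at most `C r`, while points that differ in all
coordinates are at distance at least `q r`. -/
def HasCubes (M : Type*) [MetricSpace M] : Prop :=
  ∃ C : ℝ, ∀ q n : ℕ, ∃ r : ℝ, 0 < r ∧ ∃ ψ : (Fin q → ℕ) → M,
    ∀ x y : Fin q → ℕ, (∀ i, x i < n) → (∀ i, y i < n) →
      ({i | x i ≠ y i}.Subsingleton → dist (ψ x) (ψ y) ≤ C * r) ∧
      ((∀ i, x i ≠ y i) → q * r ≤ dist (ψ x) (ψ y))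

/-- For fixed `q`, the orders pulled back from the cubes of side `n` have an ultralimit in `n`, a
total preorder on all of `ℕ ^ q`. A snake of length `k` for it is increasing for `T` in some actual
cube containing it. Its two clusters have diameter at most `C r` and are at distance at least `q r`,
so the cluster estimate bounds `(k - OR) q` independently of `q`. -/
theorem HasCubes.orderRatio_eq [Nontrivial M] (hM : HasCubes M) (T : LinearOrder M) {k : ℕ}
    (hk : 1 ≤ k) : orderRatio T k = k := by
  obtain ⟨C, hC⟩ := hM
  refine le_antisymm (orderRatio_le T k) ?_
  have key : ∀ q : ℕ, 1 ≤ q → ((k : ℝ) - orderRatio T k) * q ≤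
      (2 * (k + 2) * orderRatio T k + 2 * k) * C := by
    intro q hq
    choose r hr ψ hψ using hC q
    obtain ⟨x, hx⟩ := exists_isSnake k q
      (fun u v => ∀ᶠ n in (Filter.hyperfilter ℕ : Filter ℕ), T.le (ψ n u) (ψ n v))
      (fun u v => Ultrafilter.eventually_or.1 (Filter.Eventually.of_forall fun n => T.le_total _ _))
      (fun u v w h1 h2 => by
        filter_upwards [h1, h2] with n h3 h4 using T.le_trans _ _ _ h3 h4)
    obtain ⟨b, hb⟩ : ∃ b, ∀ i ≤ k, ∀ j, x i j < b := by
      refine ⟨(∑ i ∈ Finset.range (k + 1), ∑ j, x i j) + 1, fun i hi j => Nat.lt_succ_iff.2 ?_⟩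
      exact (Finset.single_le_sum (f := fun j => x i j) (fun _ _ => Nat.zero_le _)
        (Finset.mem_univ j)).trans (Finset.single_le_sum (f := fun i => ∑ j, x i j)
          (fun _ _ => Nat.zero_le _) (Finset.mem_range.2 (Nat.lt_succ_iff.2 hi)))
    have h1 : ∀ᶠ n in (Filter.hyperfilter ℕ : Filter ℕ), ∀ i ∈ Finset.range k,
        T.le (ψ n (x i)) (ψ n (x (i + 1))) :=
      (Filter.eventually_all_finset _).2 fun i hi => hx.chain i (Finset.mem_range.1 hi)
    obtain ⟨n, hn, hbn⟩ :=
      (h1.and (Nat.hyperfilter_le_atTop (Filter.eventually_ge_atTop b))).exists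
    have hbn : b ≤ n := hbn
    have hx' : ∀ i ≤ k, ∀ j, x i j < n := fun i hi j => (hb i hi j).trans_le hbn
    have hfar : ∀ i < k, q * r n ≤ dist (ψ n (x i)) (ψ n (x (i + 1))) := fun i hi =>
      (hψ n _ _ (hx' i hi.le) (hx' (i + 1) hi)).2
        (hx.far i hi.le (i + 1) hi (by rw [Nat.even_add_one]; tauto))
    have hq' : (1 : ℝ) ≤ q := by exact_mod_cast hq
    have hlt : ∀ i < k, T.lt (ψ n (x i)) (ψ n (x (i + 1))) := fun i hi => by
      let := T
      refine lt_of_le_of_ne (hn i (Finset.mem_range.2 hi)) fun h => ?_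
      have := hfar i hi
      rw [h, dist_self] at this
      nlinarith [hr n]
    have := le_orderRatio_of_clusters T hk (y := fun i => ψ n (x i)) hlt (δ := C * r n)
      fun i hi j hj hij => (hψ n _ _ (hx' i hi) (hx' j hj)).1 (hx.near i hi j hj hij)
    have h0 := hfar 0 hk
    have h2 : ((k : ℝ) - orderRatio T k) * (q * r n) ≤
        ((2 * (k + 2) * orderRatio T k + 2 * k) * C) * r n := by
      have := mul_le_mul_of_nonneg_left h0 (sub_nonneg.2 (orderRatio_le T k))
      simp only [zero_add] at this
      linarith
    rw [← mul_assoc] at h2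
    exact le_of_mul_le_mul_right h2 (hr n)
  by_contra! hlt
  obtain ⟨q, hq⟩ := exists_nat_gt
    ((2 * (k + 2) * orderRatio T k + 2 * k) * C / ((k : ℝ) - orderRatio T k))
  rw [div_lt_iff₀ (sub_pos.2 hlt)] at hq
  have h1 := key (q + 1) (Nat.le_add_left 1 q)
  push_cast at h1
  nlinarith

end PathLength

/-! ### Hierarchical orders on spaces of finite Assouad-Nagata dimension -/

section Hierarchy

variable {M : Type*} [MetricSpace M]

/-- Let `h y` be a member of the cover containing the `r`-ball around `y`, and let `σ y` be a
representative of the fibre of `h` through `y`. If `y` is within `r` of `x`, then `h y` contains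
`x`, which leaves at most `m + 1` choices. -/
theorem ANDimLE.exists_retraction {m : ℕ} (h : ANDimLE M m) :
    ∃ K : ℝ, 0 < K ∧ ∀ r : ℝ, 0 < r → ∃ σ : M → M, (∀ y, dist (σ y) y ≤ K * r) ∧
      ∀ x, (σ '' Metric.closedBall x r).encard ≤ m + 1 := by
  obtain ⟨K, hK, hU⟩ := h
  refine ⟨K, hK, fun r hr => ?_⟩
  obtain ⟨U, -, hdiam, hleb, hmult⟩ := hU r hr
  choose h hhU hh using fun y : M => hleb y r le_rfl
  have hmem : ∀ y, y ∈ h y := fun y => hh y (Metric.mem_closedBall_self hr.le)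
  rcases isEmpty_or_nonempty M with hM | hM
  · exact ⟨id, fun y => hM.elim y, fun x => hM.elim x⟩
  have hinv : ∀ y, h (Function.invFun h (h y)) = h y := fun y =>
    Function.invFun_eq (f := h) ⟨y, rfl⟩
  refine ⟨fun y => Function.invFun h (h y), fun y => hdiam (h y) (hhU y) _ ?_ y (hmem y),
    fun x => le_trans ?_ (hmult x)⟩
  · have := hmem (Function.invFun h (h y))
    rwa [hinv] at this
  · refine (encard_le_encard ?_).trans (encard_image_le (Function.invFun h) _)
    rintro _ ⟨y, hy, rfl⟩
    exact ⟨h y, ⟨hhU y, hh y (Metric.mem_closedBall'.2 hy)⟩, rfl⟩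

/-- Composing the retractions at scales `lam ^ (j + 1)` makes the partitions into fibres nested, and
the displacements add up geometrically. -/
theorem FiniteANDim.exists_hierarchy (hd : ∀ x y : M, x ≠ y → 1 ≤ dist x y)
    (h : FiniteANDim M) : ∃ (m : ℕ) (K lam : ℝ) (c : ℕ → M → M), 0 < K ∧ 2 ≤ lam ∧
      (∀ x, c 0 x = x) ∧ (∀ j x y, c j x = c j y → c (j + 1) x = c (j + 1) y) ∧
      (∀ j x, dist (c j x) x ≤ K * lam ^ j) ∧
      ∀ j x, (c j '' Metric.closedBall x (lam ^ j / 2)).encard ≤ m + 1 := by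
  obtain ⟨m, hm⟩ := h
  obtain ⟨K, hK, hσ⟩ := hm.exists_retraction
  -- Since `lam ≥ 4 K`, the displacement `2 K lam ^ j` of `c j` is at most `lam ^ (j + 1) / 2`: a
  -- ball of that radius lands in one of radius `lam ^ (j + 1)`, where `σ j` takes few values.
  set lam : ℝ := 4 * K + 4 with hlam
  have hl0 : 0 < lam := by positivity
  choose σ hσ1 hσ2 using fun j : ℕ => hσ (lam ^ (j + 1)) (by positivity)
  let c : ℕ → M → M := fun j => Nat.rec id (fun j f x => σ j (f x)) j
  have hc : ∀ j x, c (j + 1) x = σ j (c j x) := fun _ _ => rfl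
  have hdist : ∀ j x, dist (c j x) x ≤ 2 * K * lam ^ j := by
    intro j x
    induction j with
    | zero => simpa [c] using hK.le
    | succ j ih =>
      have h1 := hσ1 j (c j x)
      have h2 := dist_triangle (c (j + 1) x) (c j x) x
      rw [hc] at h2 ⊢
      have h3 : 0 < lam ^ j := by positivity
      rw [pow_succ] at h1 ⊢
      nlinarith [mul_pos hK h3, mul_pos (mul_pos hK hK) h3]
  refine ⟨m, 2 * K, lam, c, by positivity, by linarith, fun x => rfl, fun j x y hxy => ?_, hdist,
    fun j x => ?_⟩
  · rw [hc, hc, hxy]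
  · cases j with
    | zero =>
      -- At level `0` the radius is `1 / 2`, and uniform discreteness leaves a single point.
      have : c 0 '' Metric.closedBall x (lam ^ 0 / 2) ⊆ {x} := by
        rintro _ ⟨y, hy, rfl⟩
        by_contra hne
        have h1 := hd y x hne
        have h2 := Metric.mem_closedBall.1 hy
        norm_num at h2
        linarith
      refine (encard_le_encard this).trans ?_
      rw [encard_singleton]
      exact le_add_self
    | succ j =>
      refine (encard_le_encard ?_).trans (hσ2 j x)
      rintro _ ⟨y, hy, rfl⟩
      refine ⟨c j y, ?_, rfl⟩
      rw [Metric.mem_closedBall] at hy ⊢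
      have h1 := hdist j y
      have h2 := dist_triangle (c j y) y x
      have h3 : 0 < lam ^ j := by positivity
      rw [pow_succ] at hy ⊢
      nlinarith [mul_pos hK h3]

theorem exists_linearOrder_of_le {X : Type*} {r : X → X → Prop} (refl : ∀ x, r x x)
    (trans : ∀ x y z, r x y → r y z → r x z) (antisymm : ∀ x y, r x y → r y x → x = y)
    (total : ∀ x y, r x y ∨ r y x) : ∃ T : LinearOrder X, ∀ x y, T.lt x y → r x y :=
  ⟨{ le := r
     le_refl := refl
     le_trans := trans
     le_antisymm := antisymm
     le_total := total
     toDecidableLE := Classical.decRel _ }, fun _ _ h => h.1⟩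

/-- For a sequence of successively coarser partitions (the fibres of `c j`) there is a total order
for which all cells are convex. -/
theorem exists_linearOrder_convex {X : Type*} (c : ℕ → X → X) (h0 : ∀ x, c 0 x = x)
    (hc : ∀ j x y, c j x = c j y → c (j + 1) x = c (j + 1) y) :
    ∃ T : LinearOrder X, ∀ j x y z, T.lt x y → T.lt y z → c j x = c j z → c j x = c j y := by
  classical
  let base : LinearOrder X := linearOrderOfSTO WellOrderingRel
  have hc' : ∀ i j, i ≤ j → ∀ x y, c i x = c i y → c j x = c j y := by
    intro i j hij x y h
    induction j, hij using Nat.le_induction with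
    | base => exact h
    | succ j _ ih => exact hc j x y ih
  -- `le j` is lexicographic: the cells of level `j` are compared first, then those of level `j -
  -- 1`, down to the points. All cells of level at most `j` are convex for it.
  let le : ℕ → X → X → Prop := fun j => Nat.rec (fun x y => x ≤ y)
    (fun j r x y => c (j + 1) x < c (j + 1) y ∨ c (j + 1) x = c (j + 1) y ∧ r x y) j
  have le_succ : ∀ j x y, le (j + 1) x y ↔
    c (j + 1) x < c (j + 1) y ∨ c (j + 1) x = c (j + 1) y ∧ le j x y := fun _ _ _ => Iff.rfl
  have refl : ∀ j x, le j x x := fun j x => by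
    induction j with
    | zero => exact le_refl x
    | succ j ih => exact Or.inr ⟨rfl, ih⟩
  have tot : ∀ j x y, le j x y ∨ le j y x := fun j x y => by
    induction j with
    | zero => exact le_total x y
    | succ j ih =>
      rw [le_succ, le_succ]
      rcases lt_trichotomy (c (j + 1) x) (c (j + 1) y) with h | h | h
      · exact Or.inl (Or.inl h)
      · exact ih.imp (fun h' => Or.inr ⟨h, h'⟩) fun h' => Or.inr ⟨h.symm, h'⟩
      · exact Or.inr (Or.inl h)
  have trans : ∀ j x y z, le j x y → le j y z → le j x z := fun j x y z => by
    induction j with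
    | zero => exact le_trans
    | succ j ih =>
      rw [le_succ, le_succ, le_succ]
      rintro (h1 | ⟨h1, h1'⟩) (h2 | ⟨h2, h2'⟩)
      · exact Or.inl (h1.trans h2)
      · exact Or.inl (h2 ▸ h1)
      · exact Or.inl (h1 ▸ h2)
      · exact Or.inr ⟨h1.trans h2, ih h1' h2'⟩
  have antisymm : ∀ j x y, le j x y → le j y x → x = y := fun j x y => by
    induction j with
    | zero => exact le_antisymm
    | succ j ih =>
      rw [le_succ, le_succ]
      rintro (h1 | ⟨h1, h1'⟩) (h2 | ⟨h2, h2'⟩)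
      · exact absurd h2 h1.not_gt
      · exact absurd h2 h1.ne'
      · exact absurd h1 h2.ne'
      · exact ih h1' h2'
  have mono : ∀ j x y, le j x y → c j x ≤ c j y := fun j x y => by
    cases j with
    | zero => rw [h0, h0]; exact id
    | succ j => exact fun h => h.elim le_of_lt fun h => h.1.le
  have convex : ∀ j i, i ≤ j → ∀ x y z, le j x y → le j y z → c i x = c i z → c i x = c i y := by
    intro j
    induction j with
    | zero =>
      intro i hi x y z h1 h2 h3
      obtain rfl : i = 0 := by omega
      rw [h0, h0] at h3 ⊢
      subst h3
      exact antisymm 0 x y h1 h2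
    | succ j ih =>
      intro i hi x y z h1 h2 h3
      have h4 := hc' i (j + 1) hi x z h3
      have h5 : c (j + 1) x = c (j + 1) y :=
        le_antisymm (mono _ _ _ h1) (h4 ▸ mono _ _ _ h2)
      rcases hi.lt_or_eq with hi | rfl
      · have h1' := (h1.resolve_left h5.not_lt).2
        have h2' := (h2.resolve_left (h5.symm.trans h4).not_lt).2
        exact ih i (Nat.lt_succ_iff.1 hi) x y z h1' h2' h3
      · exact h5
  -- Points whose cells never merge may be compared differently at different levels; the ultrafilter
  -- decides. Convexity at level `i` holds for all `le j` with `j ≥ i`, hence in the limit.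
  obtain ⟨T, hT⟩ := exists_linearOrder_of_le
    (r := fun x y => ∀ᶠ j in (Filter.hyperfilter ℕ : Filter ℕ), le j x y)
    (fun x => Filter.Eventually.of_forall fun j => refl j x)
    (fun x y z h1 h2 => by filter_upwards [h1, h2] with j h3 h4 using trans j x y z h3 h4)
    (fun x y h1 h2 => by
      obtain ⟨j, h3, h4⟩ := (h1.and h2).exists
      exact antisymm j x y h3 h4)
    (fun x y => Ultrafilter.eventually_or.1 (Filter.Eventually.of_forall fun j => tot j x y))
  refine ⟨T, fun i x y z h1 h2 h3 => ?_⟩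
  obtain ⟨j, h4, h5, h6⟩ := ((hT x y h1).and ((hT y z h2).and
    (Nat.hyperfilter_le_atTop (Filter.eventually_ge_atTop i)))).exists
  exact convex j i h6 x y z h4 h5 h3

open scoped Classical in
/-- A path of length `L` meets at most about `(m + 1) L / δ` fibres of a map which takes at most
`m + 1` values on every ball of radius `δ`. -/
theorem card_image_sdiff_le_of_path {f : M → M} {δ : ℝ} (hδ : 0 < δ) {m : ℕ} {F : M → Finset M}
    (hF : ∀ x, (F x).card ≤ m + 1) (hfF : ∀ x y, dist x y ≤ δ → f y ∈ F x)
    (l : List M) (x z : M) (a : ℝ) (hz : dist z x ≤ a) :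
    (((x :: l).toFinset.image f \ F z).card : ℝ) ≤ (m + 1) * (a + pathLength (x :: l)) / δ := by
  induction l generalizing x z a with
  | nil =>
    rw [le_div_iff₀ hδ, pathLength_singleton, add_zero]
    have ha : 0 ≤ a := dist_nonneg.trans hz
    rcases le_or_gt a δ with h | h
    · have : ([x].toFinset.image f \ F z) = ∅ := by
        simp [Finset.sdiff_eq_empty_iff_subset, hfF z x (hz.trans h)]
      rw [this]
      simp only [Finset.card_empty, Nat.cast_zero, zero_mul]
      positivity
    · have h1 : (([x].toFinset.image f \ F z).card : ℝ) ≤ 1 := by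
        have : ([x].toFinset.image f \ F z).card ≤ 1 :=
          (Finset.card_le_card Finset.sdiff_subset).trans (by simp)
        exact_mod_cast this
      have : (0 : ℝ) ≤ m := Nat.cast_nonneg m
      nlinarith
  | cons y l ih =>
    rw [pathLength_cons_cons]
    -- While the budget `a` is at most `δ`, the value at `x` already lies in `F z`. Once it exceeds
    -- `δ`, `x` replaces `z` as reference point, and its at most `m + 1` values are paid for by that
    -- length.
    rcases le_or_gt a δ with h | h
    · have h1 := ih y z (a + dist x y) ((dist_triangle z x y).trans (by linarith))
      have h2 : (x :: y :: l).toFinset.image f \ F z = (y :: l).toFinset.image f \ F z := by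
        rw [List.toFinset_cons (a := x), Finset.image_insert,
          Finset.insert_sdiff_of_mem _ (hfF z x (hz.trans h))]
      rw [h2]
      rwa [add_assoc] at h1
    · have h1 := ih y x (dist x y) le_rfl
      have h2 : (x :: y :: l).toFinset.image f \ F z ⊆
          F x ∪ ((y :: l).toFinset.image f \ F x) := by
        intro w hw
        rw [Finset.union_sdiff_self_eq_union, Finset.mem_union]
        rw [Finset.mem_sdiff, List.toFinset_cons (a := x), Finset.image_insert,
          Finset.mem_insert] at hw
        rcases hw.1 with rfl | hw
        · exact Or.inl (hfF x x (by rw [dist_self]; exact hδ.le))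
        · exact Or.inr hw
      have h3 := (Finset.card_le_card h2).trans (Finset.card_union_le _ _)
      have h4 : (((x :: y :: l).toFinset.image f \ F z).card : ℝ) ≤
          (m + 1) + (((y :: l).toFinset.image f \ F x).card : ℝ) := by
        exact_mod_cast h3.trans (Nat.add_le_add_right (hF x) _)
      rw [le_div_iff₀ hδ] at h1 ⊢
      have : (0 : ℝ) ≤ m := Nat.cast_nonneg m
      nlinarith

open scoped Classical in
theorem card_image_le_of_path {f : M → M} {δ : ℝ} (hδ : 0 < δ) {m : ℕ}
    (hf : ∀ x, (f '' Metric.closedBall x δ).encard ≤ m + 1) {X : Finset M} {l : List M}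
    (hX : ∀ x ∈ X, x ∈ l) :
    ((X.image f).card : ℝ) ≤ (m + 1) * (1 + pathLength l / δ) := by
  have hfin : ∀ x, (f '' Metric.closedBall x δ).Finite := fun x =>
    finite_of_encard_le_coe (k := m + 1) (by exact_mod_cast hf x)
  have hF : ∀ x, (hfin x).toFinset.card ≤ m + 1 := fun x => by
    have := hf x
    rw [(hfin x).encard_eq_coe_toFinset_card] at this
    exact_mod_cast this
  have hpl := pathLength_nonneg l
  cases l with
  | nil =>
    have : X = ∅ := Finset.eq_empty_of_forall_notMem fun x hx => by simpa using hX x hx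
    subst this
    simp only [Finset.image_empty, Finset.card_empty, Nat.cast_zero]
    positivity
  | cons x l =>
    have h1 := card_image_sdiff_le_of_path hδ hF (f := f) (fun x y h => by
      rw [Set.Finite.mem_toFinset]
      exact ⟨y, Metric.mem_closedBall'.2 h, rfl⟩) l x x 0 (by simp)
    have h2 : X.image f ⊆ (hfin x).toFinset ∪
        ((x :: l).toFinset.image f \ (hfin x).toFinset) := by
      rw [Finset.union_sdiff_self_eq_union]
      exact (Finset.image_subset_image fun y hy => List.mem_toFinset.2 (hX y hy)).trans
        Finset.subset_union_right
    have h3 := (Finset.card_le_card h2).trans (Finset.card_union_le _ _)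
    have h4 : ((X.image f).card : ℝ) ≤
        (m + 1) + (((x :: l).toFinset.image f \ (hfin x).toFinset).card : ℝ) := by
      exact_mod_cast h3.trans (Nat.add_le_add_right (hF x) _)
    rw [zero_add] at h1
    calc _ ≤ _ := h4
      _ ≤ _ := add_le_add_right h1 _
      _ = _ := by ring

open scoped Classical in
/-- The number of consecutive pairs of a list on which `f` takes different values. -/
noncomputable def changeCount {Y : Type*} (f : Y → Y) : List Y → ℕ
  | [] => 0
  | [_] => 0
  | x :: y :: l => (if f x = f y then 0 else 1) + changeCount f (y :: l)

open scoped Classical in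
-- The fibres are convex, so an increasing list never returns to a fibre it has left; each change
-- uses up a value.
theorem changeCount_le_card {Y : Type*} {T : LinearOrder Y} {f : Y → Y}
    (hf : ∀ x y z, T.lt x y → T.lt y z → f x = f z → f x = f y) {l : List Y}
    (hl : l.Pairwise T.lt) : changeCount f l ≤ (l.toFinset.image f).card := by
  induction l with
  | nil => simp [changeCount]
  | cons x l ih =>
    cases l with
    | nil => simp [changeCount]
    | cons y l =>
      rw [List.pairwise_cons] at hl
      have ih := ih hl.2
      rw [changeCount, List.toFinset_cons (a := x), Finset.image_insert]
      by_cases h : f x = f y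
      · rw [if_pos h, zero_add]
        exact ih.trans (Finset.card_le_card (Finset.subset_insert _ _))
      · rw [if_neg h, Finset.card_insert_of_notMem]
        · omega
        · intro hmem
          rw [Finset.mem_image] at hmem
          obtain ⟨z, hz, hzx⟩ := hmem
          rw [List.mem_toFinset, List.mem_cons] at hz
          rcases hz with rfl | hz
          · exact h hzx.symm
          · exact h (hf x y z (hl.1 y (by simp)) ((List.pairwise_cons.1 hl.2).1 z hz) hzx.symm)

/-- A consecutive pair in one cell of level `p` costs at most `e`. A pair separated at level `p + j`
but together at level `p + j + 1` costs at most `D (p + j + 1)`, and one still separated at level `p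
+ t` at most `L`. -/
theorem pathLength_le_sum_changeCount {c : ℕ → M → M} {D : ℕ → ℝ} (hD0 : ∀ j, 0 ≤ D j)
    (hD : ∀ j x y, c j x = c j y → dist x y ≤ D j) {p : ℕ} {e L : ℝ} (he0 : 0 ≤ e)
    (he : ∀ x y, c p x = c p y → dist x y ≤ e) (t : ℕ) {l : List M}
    (hL : ∀ x ∈ l, ∀ y ∈ l, dist x y ≤ L) :
    pathLength l ≤ l.length * e + ∑ j ∈ Finset.range t, D (p + j + 1) * changeCount (c (p + j)) l +
      L * changeCount (c (p + t)) l := by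
  classical
  have pair : ∀ x y, dist x y ≤ L → dist x y ≤ e +
      ∑ j ∈ Finset.range t, D (p + j + 1) * (if c (p + j) x = c (p + j) y then (0 : ℝ) else 1) +
      L * (if c (p + t) x = c (p + t) y then (0 : ℝ) else 1) := by
    intro x y hxy
    have hL0 : 0 ≤ L := dist_nonneg.trans hxy
    have hnn : ∀ t, 0 ≤ ∑ j ∈ Finset.range t,
        D (p + j + 1) * (if c (p + j) x = c (p + j) y then (0 : ℝ) else 1) := fun t =>
      Finset.sum_nonneg fun j _ => mul_nonneg (hD0 _) (by split_ifs <;> norm_num)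
    clear hL
    induction t with
    | zero =>
      by_cases h : c p x = c p y
      · simpa [h] using he x y h
      · simp [h]; linarith
    | succ t ih =>
      have hn := hnn t
      by_cases h : c (p + (t + 1)) x = c (p + (t + 1)) y
      · rw [Finset.sum_range_succ, if_pos h]
        by_cases h' : c (p + t) x = c (p + t) y
        · simpa [h'] using ih
        · have := hD _ x y h
          rw [if_neg h', add_assoc p t 1]
          linarith
      · have := hnn (t + 1)
        rw [if_neg h]
        linarith
  induction l with
  | nil => simp [pathLength, changeCount]
  | cons x l ih =>
    cases l with
    | nil => simpa [pathLength, changeCount] using he0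
    | cons y l =>
      have ih := ih fun a ha b hb => hL a (List.mem_cons_of_mem _ ha) b (List.mem_cons_of_mem _ hb)
      have h1 := pair x y (hL x (by simp) y (by simp))
      rw [pathLength_cons_cons]
      simp only [changeCount, Nat.cast_add, Nat.cast_ite, Nat.cast_zero, Nat.cast_one, mul_add,
        Finset.sum_add_distrib, List.length_cons, add_mul, one_mul] at ih ⊢
      linarith

theorem clog_two_le {k : ℕ} (hk : 2 ≤ k) :
    (Nat.clog 2 k : ℝ) ≤ 2 * (Real.log k / Real.log 2) := by
  have h2 : 0 < Real.log 2 := Real.log_pos one_lt_two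
  have h3 : Real.log 2 ≤ Real.log k := Real.log_le_log two_pos (by exact_mod_cast hk)
  have h4 := Nat.pow_pred_clog_lt_self one_lt_two (show 1 < k by omega)
  have h5 : ((2 : ℝ) ^ (Nat.clog 2 k).pred) ≤ k := by exact_mod_cast h4.le
  have h6 := Real.log_le_log (by positivity) h5
  rw [Real.log_pow] at h6
  have h7 : (Nat.clog 2 k : ℝ) ≤ (Nat.clog 2 k).pred + 1 := by
    exact_mod_cast (by rw [Nat.pred_eq_sub_one]; omega)
  rw [← mul_div_assoc, le_div_iff₀ h2]
  nlinarith

/-- A uniformly discrete space of finite Assouad-Nagata dimension admits an order with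
logarithmic order ratio function. -/
theorem FiniteANDim.exists_orderRatio_le_log [Nontrivial M]
    (hd : ∀ x y : M, x ≠ y → 1 ≤ dist x y) (h : FiniteANDim M) :
    ∃ T : LinearOrder M, ∃ C : ℝ, 0 < C ∧ ∀ k : ℕ, 2 ≤ k → orderRatio T k ≤ C * Real.log k := by
  classical
  obtain ⟨m, K, lam, c, hK, hlam, h0, hc, hdist, hmult⟩ := h.exists_hierarchy hd
  obtain ⟨T, hT⟩ := exists_linearOrder_convex c h0 hc
  have h2 : 0 < Real.log 2 := Real.log_pos one_lt_two
  have hl0 : 0 < lam := by linarith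
  have hl1 : 1 ≤ lam := by linarith
  refine ⟨T, (4 * K * lam + 3 * (m + 1) + 12 * K * lam * (m + 1)) / Real.log 2,
    by positivity, fun k hk => ?_⟩
  have hkR : (2 : ℝ) ≤ k := by exact_mod_cast hk
  have hlogk : Real.log 2 ≤ Real.log k := Real.log_le_log two_pos hkR
  have hlogpos : 0 < Real.log k := h2.trans_le hlogk
  have hlk : 1 ≤ Real.log k / Real.log 2 := (one_le_div h2).2 hlogk
  refine orderRatio_le_of_forall T (by positivity) fun X hX2 hXk => ?_
  rw [← div_le_iff₀' (by positivity)]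
  refine le_optLength fun l' hl' => ?_
  rw [div_le_iff₀' (by positivity)]
  set L := pathLength l' with hLdef
  obtain ⟨l, hlT, hlX, hlen, hlo⟩ := exists_list_orderLength T X
  have hLd : ∀ x ∈ X, ∀ y ∈ X, dist x y ≤ L := fun x hx y hy =>
    dist_le_pathLength (hl' x hx) (hl' y hy)
  have hL1 : 1 ≤ L := by
    obtain ⟨x, hx, y, hy, hxy⟩ := Finset.one_lt_card.1 hX2
    exact (hd x y hxy).trans (hLd x hx y hy)
  have hex : ∃ n : ℕ, L ≤ lam ^ n := by
    obtain ⟨n, hn⟩ := pow_unbounded_of_one_lt L (show 1 < lam by linarith)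
    exact ⟨n, hn.le⟩
  -- At level `q` the optimal path meets boundedly many cells; below it, `lam ^ j < L` turns each
  -- level's contribution into `O(L)`.
  obtain ⟨q, hq, hqmin⟩ : ∃ q : ℕ, L ≤ lam ^ q ∧ ∀ j < q, lam ^ j < L :=
    ⟨Nat.find hex, Nat.find_spec hex, fun j hj => not_le.1 (Nat.find_min hex hj)⟩
  set t₀ := Nat.clog 2 k with ht₀
  have htk : (k : ℝ) ≤ lam ^ t₀ := by
    have h1 : k ≤ 2 ^ t₀ := Nat.le_pow_clog one_lt_two k
    have h3 : (k : ℝ) ≤ 2 ^ t₀ := by exact_mod_cast h1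
    exact h3.trans (pow_le_pow_left₀ two_pos.le hlam t₀)
  -- Only the top `t₀`, about `log k`, levels are counted. Below them cells have diameter `O(L /
  -- k)`, so at most `k + 1` points lose `O(L)` in total. If fewer than `t₀` levels exist then `p =
  -- 0`, where cells are points.
  obtain ⟨p, t, hpt, htt, hp⟩ : ∃ p t, p + t = q ∧ t ≤ t₀ ∧ (p = 0 ∨ t = t₀) :=
    ⟨q - t₀, q - (q - t₀), by omega, by omega, by omega⟩
  have hD : ∀ j x y, c j x = c j y → dist x y ≤ 2 * K * lam ^ j := fun j x y hxy => by
    have h1 := hdist j x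
    have h3 := hdist j y
    have h4 := dist_triangle_left x y (c j x)
    rw [hxy] at h1 h4
    linarith
  have he : ∀ x y, c p x = c p y → dist x y ≤ 2 * K * lam * L / k := fun x y hxy => by
    rcases hp with rfl | rfl
    · rw [h0, h0] at hxy
      rw [hxy, dist_self]
      positivity
    · rcases Nat.eq_zero_or_pos p with rfl | hp0
      · rw [h0, h0] at hxy
        rw [hxy, dist_self]
        positivity
      refine (hD p x y hxy).trans ?_
      rw [le_div_iff₀ (by positivity)]
      have h1 := hqmin (q - 1) (by omega)
      have h3 : lam ^ q = lam * lam ^ (q - 1) := by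
        rw [← pow_succ']; congr 1; omega
      have h4 : lam ^ p * k ≤ lam * L := by
        calc lam ^ p * k ≤ lam ^ p * lam ^ t₀ := by gcongr
          _ = lam * lam ^ (q - 1) := by rw [← pow_add, hpt, h3]
          _ ≤ lam * L := by gcongr
      nlinarith
  have hcount : ∀ j, (changeCount (c j) l : ℝ) ≤ (m + 1) * (1 + L / (lam ^ j / 2)) := fun j => by
    have h1 := changeCount_le_card (hT j) hlT
    have h3 : l.toFinset = X := by ext x; simp [hlX]
    rw [h3] at h1
    refine (Nat.cast_le.2 h1).trans ?_
    refine le_trans (le_of_eq ?_) (card_image_le_of_path (by positivity) (hmult j) hl')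
    congr!
  have hsum := pathLength_le_sum_changeCount (c := c) (D := fun j => 2 * K * lam ^ j)
    (fun j => by positivity) hD (p := p) (by positivity) he t (l := l) (L := L)
    fun x hx y hy => hLd x ((hlX x).1 hx) y ((hlX y).1 hy)
  have hterm : ∑ j ∈ Finset.range t, 2 * K * lam ^ (p + j + 1) * (changeCount (c (p + j)) l : ℝ) ≤
      t * (6 * K * lam * (m + 1) * L) := by
    rw [← nsmul_eq_mul, ← Finset.card_range t, Finset.card_range t]
    refine (Finset.sum_le_card_nsmul _ _ (6 * K * lam * (m + 1) * L) fun j hj => ?_).trans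
      (by rw [Finset.card_range])
    have h1 := hcount (p + j)
    have h3 := hqmin (p + j) (by have := Finset.mem_range.1 hj; omega)
    have h5 : 0 < lam ^ (p + j) := by positivity
    have h4 : lam ^ (p + j) * (changeCount (c (p + j)) l : ℝ) ≤ 3 * (m + 1) * L := by
      calc _ ≤ lam ^ (p + j) * ((m + 1) * (1 + L / (lam ^ (p + j) / 2))) := by gcongr
        _ = (m + 1) * (lam ^ (p + j) + 2 * L) := by field_simp
        _ ≤ (m + 1) * (L + 2 * L) := by gcongr
        _ = _ := by ring
    calc _ = 2 * K * lam * (lam ^ (p + j) * (changeCount (c (p + j)) l : ℝ)) := by ring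
      _ ≤ 2 * K * lam * (3 * (m + 1) * L) := by gcongr
      _ = _ := by ring
  have hlast : L * (changeCount (c (p + t)) l : ℝ) ≤ L * (3 * (m + 1)) := by
    rw [hpt]
    refine mul_le_mul_of_nonneg_left ((hcount q).trans ?_) (by linarith)
    have : L / (lam ^ q / 2) ≤ 2 := by
      rw [div_le_iff₀ (by positivity)]; linarith
    nlinarith [Nat.cast_nonneg (α := ℝ) m]
  have hfirst : (l.length : ℝ) * (2 * K * lam * L / k) ≤ 4 * K * lam * L := by
    have h1 : (l.length : ℝ) ≤ 2 * k := by
      rw [hlen]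
      exact_mod_cast (by omega : X.card ≤ 2 * k)
    calc _ ≤ 2 * k * (2 * K * lam * L / k) := by gcongr
      _ = _ := by field_simp; ring
  have ht : (t : ℝ) ≤ 2 * (Real.log k / Real.log 2) :=
    (Nat.cast_le.2 htt).trans (clog_two_le hk)
  rw [hlo]
  have hA : 0 ≤ 6 * K * lam * (m + 1) * L := by positivity
  have hB : 0 ≤ (4 * K * lam + 3 * (m + 1)) * L := by positivity
  calc pathLength l ≤ (4 * K * lam + 3 * (m + 1)) * L * 1 + t * (6 * K * lam * (m + 1) * L) := by
        linarith
    _ ≤ (4 * K * lam + 3 * (m + 1)) * L * (Real.log k / Real.log 2) +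
        2 * (Real.log k / Real.log 2) * (6 * K * lam * (m + 1) * L) := by gcongr
    _ = _ := by ring

end Hierarchy

/-! ### Word lengths -/

section WordLengthEstimates

variable {G : Type*} [Group G] {S : Set G}

theorem wordLength_le_one {s : G} (hs : s ∈ S) : wordLength S s ≤ 1 := by
  simpa using wordLength_le (S := S) [s] (by simp [hs])

theorem wordLength_inv (hS : Subgroup.closure S = ⊤) (g : G) :
    wordLength S g⁻¹ = wordLength S g :=
  le_antisymm (wordLength_inv_le hS g) (by simpa using wordLength_inv_le hS g⁻¹)

theorem wordLength_pos (hS : Subgroup.closure S = ⊤) {g : G} (hg : g ≠ 1) :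
    1 ≤ wordLength S g :=
  Nat.one_le_iff_ne_zero.2 fun h => hg (eq_one_of_wordLength_eq_zero hS h)

/-- A pseudo-distance that is at most `F` on the edges of the Cayley graph is at most `F` times
the word metric. -/
theorem le_mul_wordLength (hS : Subgroup.closure S = ⊤) {Φ : G → G → ℕ} {F : ℕ}
    (h0 : ∀ g, Φ g g = 0) (hsymm : ∀ g h, Φ g h = Φ h g)
    (htri : ∀ g h k, Φ g k ≤ Φ g h + Φ h k) (hF : ∀ g, ∀ s ∈ S, Φ g (g * s) ≤ F) (g h : G) :
    Φ g h ≤ F * wordLength S (g⁻¹ * h) := by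
  have key : ∀ l : List G, (∀ s ∈ l, s ∈ S ∨ s⁻¹ ∈ S) → ∀ g, Φ g (g * l.prod) ≤ F * l.length := by
    intro l
    induction l with
    | nil => intro _ g; simp [h0]
    | cons s l ih =>
      intro hl g
      have h1 : Φ g (g * s) ≤ F := by
        rcases hl s (by simp) with hs | hs
        · exact hF g s hs
        · rw [hsymm]
          simpa using hF (g * s) s⁻¹ hs
      have h2 := ih (fun t ht => hl t (List.mem_cons_of_mem _ ht)) (g * s)
      have h3 := htri g (g * s) (g * s * l.prod)
      rw [List.prod_cons, ← mul_assoc, List.length_cons, mul_add]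
      omega
  obtain ⟨l, hlen, hl, hprod⟩ := exists_word hS (g⁻¹ * h)
  have := key l hl g
  rwa [hprod, mul_inv_cancel_left, hlen] at this

theorem wordLength_map_le {H : Type*} [Group H] {S' : Set H} (hS' : Subgroup.closure S' = ⊤)
    (hS : Subgroup.closure S = ⊤) (φ : H →* G) {E : ℕ} (hE : ∀ s ∈ S', wordLength S (φ s) ≤ E)
    (h : H) : wordLength S (φ h) ≤ E * wordLength S' h := by
  have := le_mul_wordLength hS' (Φ := fun a b => wordLength S (φ (a⁻¹ * b))) (F := E)
    (fun a => by simp [wordLength_one])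
    (fun a b => by rw [← wordLength_inv hS, ← map_inv]; simp)
    (fun a b c => by
      have := wordLength_mul_le hS (φ (a⁻¹ * b)) (φ (b⁻¹ * c))
      rwa [← map_mul, show a⁻¹ * b * (b⁻¹ * c) = a⁻¹ * c by group] at this)
    (fun a s hs => by simpa using hE s hs) 1 h
  simpa using this

theorem exists_eq_mul_of_wordLength_eq_succ (hS : Subgroup.closure S = ⊤) {g : G} {n : ℕ}
    (hg : wordLength S g = n + 1) :
    ∃ g' s : G, g = g' * s ∧ wordLength S g' = n ∧ (s ∈ S ∨ s⁻¹ ∈ S) := by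
  obtain ⟨l, hlen, hl, rfl⟩ := exists_word hS g
  rcases List.eq_nil_or_concat l with rfl | ⟨l', s, rfl⟩
  · rw [hg] at hlen; simp at hlen
  · have h1 := wordLength_le (S := S) l' fun t ht => hl t (by simp [ht])
    have h2 := wordLength_mul_le hS l'.prod s
    have hs := hl s (by simp)
    have h3 : wordLength S s ≤ 1 := by
      rcases hs with hs | hs
      · exact wordLength_le_one hs
      · rw [← wordLength_inv hS]; exact wordLength_le_one hs
    simp only [List.concat_eq_append, List.prod_append, List.prod_singleton, List.length_append,
      List.length_singleton] at hlen hg ⊢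
    exact ⟨l'.prod, s, rfl, by omega, hs⟩

theorem finite_wordLength_le (hS : Subgroup.closure S = ⊤) (hfin : S.Finite) (n : ℕ) :
    {g : G | wordLength S g ≤ n}.Finite := by
  induction n with
  | zero =>
    refine (finite_singleton (1 : G)).subset fun g hg => ?_
    exact eq_one_of_wordLength_eq_zero hS (Nat.le_zero.1 hg)
  | succ n ih =>
    have hfin' : {s : G | s ∈ S ∨ s⁻¹ ∈ S}.Finite :=
      hfin.union (hfin.preimage inv_injective.injOn)
    refine (ih.union (ih.image2 (fun a s => a * s) hfin')).subset fun g hg => ?_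
    rcases Nat.lt_or_eq_of_le (show wordLength S g ≤ n + 1 from hg) with h | h
    · exact Or.inl (Nat.lt_succ_iff.1 h)
    · obtain ⟨g', s, rfl, h1, h2⟩ := exists_eq_mul_of_wordLength_eq_succ hS h
      exact Or.inr ⟨g', h1.le, s, h2, rfl⟩

/-- Finiteness of balls gives elements of arbitrarily large length, and prefixes of a shortest word
realize all smaller lengths. -/
theorem exists_wordLength_eq [Infinite G] (hS : Subgroup.closure S = ⊤) (hfin : S.Finite) (n : ℕ) :
    ∃ g : G, wordLength S g = n := by
  obtain ⟨g, hg⟩ := (finite_wordLength_le hS hfin n).infinite_compl.nonempty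
  have hg : n ≤ wordLength S g := (not_le.1 (show ¬ wordLength S g ≤ n from hg)).le
  have key : ∀ m (g : G), wordLength S g = n + m → ∃ g : G, wordLength S g = n := by
    intro m
    induction m with
    | zero => exact fun g hg => ⟨g, hg⟩
    | succ m ih =>
      intro g hg
      obtain ⟨g', s, -, h, -⟩ := exists_eq_mul_of_wordLength_eq_succ hS hg
      exact ih g' h
  exact key (wordLength S g - n) g (by omega)

end WordLengthEstimates

/-! ### The word metric of a wreath product -/

section Wreath

variable {A B : Type*} [Group A] [Group B]

/-- The embedding of the base group `A` in the wreath product. -/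
def baseHom (A B : Type*) [Group A] [Group B] : A →* restrictedWreathProduct A B where
  toFun a := ⟨RegularWreathProduct.inl a, by
    change (Function.mulSupport (1 : A → B)).Finite
    simp⟩
  map_one' := by ext <;> simp
  map_mul' a b := by ext <;> simp

open scoped Classical in
/-- The embedding of `B` in the wreath product as the lamp group at `1 : A`. -/
noncomputable def lampHom (A B : Type*) [Group A] [Group B] : B →* restrictedWreathProduct A B where
  toFun b := ⟨⟨Pi.mulSingle 1 b, 1⟩, (finite_singleton (1 : A)).subset
    (Pi.mulSupport_mulSingle_subset)⟩
  map_one' := by ext <;> simp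
  map_mul' a b := by ext <;> simp [Pi.mulSingle_mul]

@[simp] theorem baseHom_left (a : A) : (baseHom A B a).1.left = 1 := rfl

@[simp] theorem baseHom_right (a : A) : (baseHom A B a).1.right = a := rfl

open scoped Classical in
@[simp] theorem lampHom_left (b : B) : (lampHom A B b).1.left = Pi.mulSingle 1 b := rfl

@[simp] theorem lampHom_right (b : B) : (lampHom A B b).1.right = 1 := rfl

/-- The projections to `A` of the elements of `S`. -/
def baseGenerators (S : Set (restrictedWreathProduct A B)) : Set A :=
  (fun g => g.1.right) '' S

/-- The values of the lamp configurations of the elements of `S`. -/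
def lampGenerators (S : Set (restrictedWreathProduct A B)) : Set B :=
  ⋃ s ∈ S, range s.1.left

variable {S : Set (restrictedWreathProduct A B)}

theorem finite_baseGenerators (hfin : S.Finite) : (baseGenerators S).Finite := hfin.image _

theorem finite_lampGenerators (hfin : S.Finite) : (lampGenerators S).Finite := by
  refine hfin.biUnion fun s _ => ((s.2.image s.1.left).insert 1).subset ?_
  rintro _ ⟨x, rfl⟩
  by_cases h : s.1.left x = 1
  · exact Or.inl h
  · exact Or.inr ⟨x, h, rfl⟩

theorem closure_baseGenerators (hS : Subgroup.closure S = ⊤) :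
    Subgroup.closure (baseGenerators S) = ⊤ := by
  let π : restrictedWreathProduct A B →* A :=
    RegularWreathProduct.rightHom.comp (restrictedWreathProduct A B).subtype
  have h1 : baseGenerators S = π '' S := rfl
  rw [h1, ← MonoidHom.map_closure, hS, ← MonoidHom.range_eq_map, MonoidHom.range_eq_top]
  exact fun a => ⟨baseHom A B a, rfl⟩

theorem closure_lampGenerators (hS : Subgroup.closure S = ⊤) :
    Subgroup.closure (lampGenerators S) = ⊤ := by
  have key : ∀ g : restrictedWreathProduct A B, ∀ x,
      g.1.left x ∈ Subgroup.closure (lampGenerators S) := by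
    intro g
    have hg : g ∈ Subgroup.closure S := by rw [hS]; trivial
    induction hg using Subgroup.closure_induction with
    | mem s hs =>
      exact fun x => Subgroup.subset_closure (mem_biUnion hs ⟨x, rfl⟩)
    | one => exact fun x => one_mem _
    | mul g h _ _ ihg ihh => exact fun x => mul_mem (ihg x) (ihh _)
    | inv g _ ih => exact fun x => inv_mem (ih _)
  rw [eq_top_iff]
  intro b _
  simpa using key (lampHom A B b) 1

theorem wordLength_right_le (hS : Subgroup.closure S = ⊤) (g h : restrictedWreathProduct A B) :
    wordLength (baseGenerators S) (g.1.right⁻¹ * h.1.right) ≤ wordLength S (g⁻¹ * h) := by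
  have hA := closure_baseGenerators hS
  have := le_mul_wordLength hS (F := 1)
    (Φ := fun g h => wordLength (baseGenerators S) (g.1.right⁻¹ * h.1.right))
    (fun g => by simp [wordLength_one])
    (fun g h => by rw [← wordLength_inv hA]; simp)
    (fun g h k => by
      have := wordLength_mul_le hA (g.1.right⁻¹ * h.1.right) (h.1.right⁻¹ * k.1.right)
      rwa [show g.1.right⁻¹ * h.1.right * (h.1.right⁻¹ * k.1.right) = g.1.right⁻¹ * k.1.right
        by group] at this)
    (fun g s hs => by simpa using wordLength_le_one (S := baseGenerators S) ⟨s, hs, rfl⟩) g h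
  simpa using this

/-- A generator changes only the lamps in a translate of its finite support, each by one lamp
generator, so the total lamp variation is Lipschitz. -/
theorem exists_sum_wordLength_left_le (hS : Subgroup.closure S = ⊤) (hfin : S.Finite) :
    ∃ F : ℕ, ∀ (Z : Finset A) (g h : restrictedWreathProduct A B),
      ∑ x ∈ Z, wordLength (lampGenerators S) ((g.1.left x)⁻¹ * h.1.left x) ≤
        F * wordLength S (g⁻¹ * h) := by
  classical
  have hB := closure_lampGenerators hS
  have hbound : ∀ s ∈ S, ∀ Z : Finset A,
      ∑ x ∈ Z, wordLength (lampGenerators S) (s.1.left x) ≤ s.2.toFinset.card := by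
    intro s hs Z
    calc ∑ x ∈ Z, wordLength (lampGenerators S) (s.1.left x) ≤
        ∑ x ∈ Z, if x ∈ s.2.toFinset then 1 else 0 := by
          refine Finset.sum_le_sum fun x _ => ?_
          split_ifs with h
          · exact wordLength_le_one (mem_biUnion hs ⟨x, rfl⟩)
          · have : s.1.left x = 1 := by
              by_contra hne
              exact h ((Set.Finite.mem_toFinset _).2 hne)
            rw [this, wordLength_one]
      _ ≤ _ := by
          rw [← Finset.sum_filter, Finset.sum_const, smul_eq_mul, mul_one]
          exact Finset.card_le_card fun x hx => (Finset.mem_filter.1 hx).2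
  refine ⟨∑ s ∈ hfin.toFinset, s.2.toFinset.card, fun Z g h => ?_⟩
  refine le_mul_wordLength hS (Φ := fun g h : restrictedWreathProduct A B =>
    ∑ x ∈ Z, wordLength (lampGenerators S) ((g.1.left x)⁻¹ * h.1.left x))
    (fun g => by simp [wordLength_one]) (fun g h => Finset.sum_congr rfl fun x _ => ?_)
    (fun g h k => ?_) (fun g s hs => ?_) g h
  · rw [← wordLength_inv hB]; simp
  · rw [← Finset.sum_add_distrib]
    refine Finset.sum_le_sum fun x _ => ?_
    have := wordLength_mul_le hB ((g.1.left x)⁻¹ * h.1.left x) ((h.1.left x)⁻¹ * k.1.left x)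
    rwa [show (g.1.left x)⁻¹ * h.1.left x * ((h.1.left x)⁻¹ * k.1.left x) =
      (g.1.left x)⁻¹ * k.1.left x by group] at this
  · have h1 := hbound s hs (Z.image fun x => g.1.right⁻¹ * x)
    rw [Finset.sum_image (fun x _ y _ h => mul_left_cancel h)] at h1
    have h2 : ∀ x, (g.1.left x)⁻¹ * (g * s).1.left x = s.1.left (g.1.right⁻¹ * x) := fun x => by
      simp
    simp only [h2]
    exact h1.trans (Finset.single_le_sum (f := fun s : restrictedWreathProduct A B =>
      s.2.toFinset.card) (fun _ _ => Nat.zero_le _) (hfin.mem_toFinset.2 hs))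

/-- A lamp whose state differs for `g` and `h` is close to the base point of `g`. -/
theorem exists_wordLength_le_of_left_ne (hS : Subgroup.closure S = ⊤) (hfin : S.Finite) :
    ∃ D : ℕ, ∀ (g h : restrictedWreathProduct A B) (x : A), g.1.left x ≠ h.1.left x →
      wordLength (baseGenerators S) (g.1.right⁻¹ * x) ≤ wordLength S (g⁻¹ * h) + D := by
  have hA := closure_baseGenerators hS
  have hfin' : (⋃ s ∈ S, Function.mulSupport s.1.left).Finite := hfin.biUnion fun s _ => s.2
  -- A generator affects only lamps at distance at most `D` from the current base point.
  obtain ⟨D, hD⟩ := (hfin'.image (wordLength (baseGenerators S))).bddAbove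
  have hD' : ∀ s ∈ S, ∀ x, s.1.left x ≠ 1 → wordLength (baseGenerators S) x ≤ D :=
    fun s hs x hx => hD ⟨x, mem_biUnion hs hx, rfl⟩
  have key : ∀ l : List (restrictedWreathProduct A B), (∀ s ∈ l, s ∈ S ∨ s⁻¹ ∈ S) →
      ∀ g x, g.1.left x ≠ (g * l.prod).1.left x →
        wordLength (baseGenerators S) (g.1.right⁻¹ * x) ≤ l.length + D := by
    intro l
    induction l with
    | nil => intro _ g x hx; simp at hx
    | cons s l ih =>
      intro hl g x hx
      have hs := hl s (by simp)
      have h1 : wordLength (baseGenerators S) s.1.right ≤ 1 := by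
        rcases hs with hs | hs
        · exact wordLength_le_one ⟨s, hs, rfl⟩
        · rw [← wordLength_inv hA]
          exact wordLength_le_one ⟨s⁻¹, hs, rfl⟩
      have h2 := wordLength_mul_le hA s.1.right ((g * s).1.right⁻¹ * x)
      have h3 : s.1.right * ((g * s).1.right⁻¹ * x) = g.1.right⁻¹ * x := by simp [mul_assoc]
      rw [h3] at h2
      rw [List.length_cons]
      by_cases hgs : g.1.left x = (g * s).1.left x
      · rw [List.prod_cons, ← mul_assoc, hgs] at hx
        have := ih (fun t ht => hl t (List.mem_cons_of_mem _ ht)) (g * s) x hx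
        omega
      · rcases hs with hs | hs
        · have : s.1.left (g.1.right⁻¹ * x) ≠ 1 := fun h => hgs (by simp [h])
          have := hD' s hs _ this
          omega
        -- For an inverse letter the step is read backwards, from `g * s` to `g`: the changed lamp
        -- is within `D` of the base point of `g * s`, which is within `1` of that of `g`.
        · have : (s⁻¹).1.left ((g * s).1.right⁻¹ * x) ≠ 1 := fun h => hgs (by
            have h4 : s.1.left (g.1.right⁻¹ * x) = 1 := by simpa [mul_assoc] using h
            simp [h4])
          have := hD' _ hs _ this
          omega
  refine ⟨D, fun g h x hx => ?_⟩
  obtain ⟨l, hlen, hl, hprod⟩ := exists_word hS (g⁻¹ * h)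
  rw [← hlen]
  exact key l hl g x (by rwa [hprod, mul_inv_cancel_left])

/-- Upper bound for the word metric: walk along `l` and adjust the lamps on the way. -/
theorem exists_wordLength_le_path [MetricSpace A] (hS : Subgroup.closure S = ⊤) (hfin : S.Finite)
    (hA : ∀ a b : A, dist a b = wordLength (baseGenerators S) (a⁻¹ * b)) :
    ∃ E : ℕ, ∀ (l : List A) (g h : restrictedWreathProduct A B),
      (∀ x, x ∉ l → g.1.left x = h.1.left x) →
      (wordLength S (g⁻¹ * h) : ℝ) ≤
        E * ((l.map fun x => (wordLength (lampGenerators S) ((g.1.left x)⁻¹ * h.1.left x) : ℝ)).sum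
          + pathLength (g.1.right :: (l ++ [h.1.right]))) := by
  classical
  have hSA := closure_baseGenerators hS
  have hSB := closure_lampGenerators hS
  obtain ⟨E₁, hE₁⟩ := ((finite_baseGenerators hfin).image
    fun a => wordLength S (baseHom A B a)).bddAbove
  obtain ⟨E₂, hE₂⟩ := ((finite_lampGenerators hfin).image
    fun b => wordLength S (lampHom A B b)).bddAbove
  set E := max E₁ E₂ with hE
  have hbase : ∀ a b : A, (wordLength S (baseHom A B (a⁻¹ * b)) : ℝ) ≤ E * dist a b := fun a b => by
    rw [hA]
    exact_mod_cast wordLength_map_le hSA hS (baseHom A B)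
      (fun s hs => (hE₁ ⟨s, hs, rfl⟩).trans (le_max_left _ _)) (a⁻¹ * b)
  have hlamp : ∀ b : B, (wordLength S (lampHom A B b) : ℝ) ≤
      E * wordLength (lampGenerators S) b := fun b => by
    exact_mod_cast wordLength_map_le hSB hS (lampHom A B)
      (fun s hs => (hE₂ ⟨s, hs, rfl⟩).trans (le_max_right _ _)) b
  refine ⟨E, fun l => ?_⟩
  induction l with
  | nil =>
    intro g h hgh
    have h1 : g⁻¹ * h = baseHom A B (g.1.right⁻¹ * h.1.right) := by
      rw [inv_mul_eq_iff_eq_mul]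
      refine Subtype.ext (RegularWreathProduct.ext (funext fun x => ?_) ?_)
      · simpa using (hgh x (by simp)).symm
      · simp
    rw [h1]
    simpa [pathLength] using hbase g.1.right h.1.right
  | cons p l ih =>
    intro g h hgh
    set b := (g.1.left p)⁻¹ * h.1.left p with hb
    -- `k` results from `g` by walking to `p` and giving the lamp there its final state. From `k`
    -- on, only lamps along `l` may still differ from those of `h`, and no lamp cost has increased.
    set k := g * baseHom A B (g.1.right⁻¹ * p) * lampHom A B b with hk
    have hkr : k.1.right = p := by simp [hk]
    have hkl : ∀ x, k.1.left x = if x = p then h.1.left x else g.1.left x := fun x => by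
      by_cases hx : x = p
      · simp [hk, hx, hb]
      · have : p⁻¹ * x ≠ 1 := fun h => hx (inv_mul_eq_one.1 h).symm
        simp [hk, hx, Pi.mulSingle_eq_of_ne this]
    have h1 := ih k h fun x hx => by
      rw [hkl]
      split_ifs with hxp
      · rfl
      · exact hgh x (by simp [hxp, hx])
    have h2 : (wordLength S (g⁻¹ * h) : ℝ) ≤ wordLength S (baseHom A B (g.1.right⁻¹ * p)) +
        wordLength S (lampHom A B b) + wordLength S (k⁻¹ * h) := by
      have h3 := wordLength_mul_le hS (baseHom A B (g.1.right⁻¹ * p) * lampHom A B b) (k⁻¹ * h)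
      have h4 := wordLength_mul_le hS (baseHom A B (g.1.right⁻¹ * p)) (lampHom A B b)
      have h5 : baseHom A B (g.1.right⁻¹ * p) * lampHom A B b * (k⁻¹ * h) = g⁻¹ * h := by
        rw [hk]; group
      rw [h5] at h3
      exact_mod_cast h3.trans (Nat.add_le_add_right h4 _)
    have h6 : (l.map fun x =>
        (wordLength (lampGenerators S) ((k.1.left x)⁻¹ * h.1.left x) : ℝ)).sum ≤
        (l.map fun x =>
          (wordLength (lampGenerators S) ((g.1.left x)⁻¹ * h.1.left x) : ℝ)).sum := by
      refine List.sum_le_sum fun x _ => ?_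
      rw [hkl]
      split_ifs
      · simp [wordLength_one]
      · exact le_rfl
    have h7 : (0 : ℝ) ≤ E := Nat.cast_nonneg E
    have h8 := hbase g.1.right p
    have h9 := hlamp b
    rw [hkr] at h1
    rw [List.map_cons, List.sum_cons, List.cons_append, pathLength_cons_cons]
    have h10 := mul_le_mul_of_nonneg_left h6 h7
    rw [← hb]
    linarith

end Wreath

/-! ### Balls in groups with a word metric -/

section Balls

/-- Going through `v` right after `p` is a detour of length at most `2`. -/
theorem exists_perm_pathLength_insert_le {M : Type*} [MetricSpace M] {l : List M} {p v : M}
    (hp : p ∈ l) (hpv : dist p v ≤ 1) :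
    ∃ l' : List M, l'.Perm (v :: l) ∧ pathLength l' ≤ pathLength l + 2 := by
  obtain ⟨l₁, l₂, rfl⟩ := List.append_of_mem hp
  refine ⟨l₁ ++ p :: v :: l₂, ?_, ?_⟩
  · have := List.perm_middle (a := v) (l₁ := l₁ ++ [p]) (l₂ := l₂)
    simpa using this
  · rw [pathLength_append_cons, pathLength_append_cons l₁ p l₂]
    cases l₂ with
    | nil => simp only [pathLength_cons_cons, pathLength_singleton]; linarith
    | cons w l₂ =>
      simp only [pathLength_cons_cons]
      have := dist_triangle_left v w p
      linarith

theorem exists_list_union_finset {M : Type*} [MetricSpace M] {l : List M} (hl : l.Nodup)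
    (Y : Finset M) (hY : ∀ y ∈ Y, y ∉ l ∧ ∃ p ∈ l, dist p y ≤ 1) :
    ∃ l' : List M, l'.Nodup ∧ (∀ x, x ∈ l' ↔ x ∈ l ∨ x ∈ Y) ∧ l'.length = l.length + Y.card ∧
      pathLength l' ≤ pathLength l + 2 * Y.card := by
  classical
  induction Y using Finset.induction_on with
  | empty => exact ⟨l, hl, by simp, by simp, by simp⟩
  | insert v Y hv ih =>
    obtain ⟨l', h1, h2, h3, h4⟩ := ih fun y hy => hY y (Finset.mem_insert_of_mem hy)
    obtain ⟨hvl, p, hp, hpv⟩ := hY v (Finset.mem_insert_self v Y)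
    obtain ⟨l'', h5, h6⟩ := exists_perm_pathLength_insert_le ((h2 p).2 (Or.inl hp)) hpv
    refine ⟨l'', h5.nodup_iff.2 (List.nodup_cons.2 ⟨?_, h1⟩), fun x => ?_, ?_, ?_⟩
    · rw [h2]; tauto
    · rw [h5.mem_iff, List.mem_cons, h2, Finset.mem_insert]; tauto
    · rw [h5.length_eq, List.length_cons, h3, Finset.card_insert_of_notMem hv]; omega
    · rw [Finset.card_insert_of_notMem hv]; push_cast; linarith

variable {G : Type*} [Group G] {S : Set G}

/-- The number of elements of word length at most `n`. -/
noncomputable def ballCard (S : Set G) (n : ℕ) : ℕ := {g : G | wordLength S g ≤ n}.ncard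

theorem succ_le_ballCard [Infinite G] (hS : Subgroup.closure S = ⊤) (hfin : S.Finite) (n : ℕ) :
    n + 1 ≤ ballCard S n := by
  classical
  choose a ha using exists_wordLength_eq hS hfin
  have hinj : Function.Injective a := fun i j h => by rw [← ha i, ← ha j, h]
  calc n + 1 = ((Finset.range (n + 1)).image a).card := by
        rw [Finset.card_image_of_injective _ hinj, Finset.card_range]
    _ = (((Finset.range (n + 1)).image a : Finset G) : Set G).ncard := (ncard_coe_finset _).symm
    _ ≤ _ := ncard_le_ncard (fun x hx => by
        simp only [Finset.coe_image, mem_image, Finset.coe_range, mem_Iio] at hx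
        obtain ⟨i, hi, rfl⟩ := hx
        change wordLength S (a i) ≤ n
        rw [ha]; omega) (finite_wordLength_le hS hfin n)

variable [MetricSpace G]

/-- The balls of a finitely generated group can be enumerated along short paths. -/
theorem exists_enumeration_ball (hS : Subgroup.closure S = ⊤) (hfin : S.Finite)
    (hd : ∀ a b : G, dist a b = wordLength S (a⁻¹ * b)) (z : G) (n : ℕ) :
    ∃ l : List G, l.Nodup ∧ (∀ x, x ∈ l ↔ wordLength S (z⁻¹ * x) ≤ n) ∧
      l.length = ballCard S n ∧ pathLength l ≤ 2 * l.length := by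
  classical
  -- Each point of the sphere of radius `n + 1` is adjacent to the ball of radius `n`, so it is
  -- inserted into the tour at cost at most `2`.
  have hone : ∀ n, ∃ l : List G, l.Nodup ∧ (∀ x, x ∈ l ↔ wordLength S x ≤ n) ∧
      pathLength l ≤ 2 * l.length := by
    intro n
    induction n with
    | zero =>
      refine ⟨[1], by simp, fun x => ?_, by simp [pathLength]⟩
      rw [List.mem_singleton, Nat.le_zero]
      exact ⟨fun h => h ▸ wordLength_one, eq_one_of_wordLength_eq_zero hS⟩
    | succ n ih =>
      obtain ⟨l, h1, h2, h3⟩ := ih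
      have hYfin : {x : G | wordLength S x = n + 1}.Finite :=
        (finite_wordLength_le hS hfin (n + 1)).subset fun x hx => le_of_eq hx
      obtain ⟨l', h4, h5, h6, h7⟩ := exists_list_union_finset h1 hYfin.toFinset fun y hy => by
        have hy : wordLength S y = n + 1 := by simpa using hy
        refine ⟨fun h => by have := (h2 y).1 h; omega, ?_⟩
        obtain ⟨g', s, rfl, h8, h9⟩ := exists_eq_mul_of_wordLength_eq_succ hS hy
        refine ⟨g', (h2 g').2 h8.le, ?_⟩
        rw [hd, inv_mul_cancel_left]
        rcases h9 with h9 | h9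
        · exact_mod_cast wordLength_le_one h9
        · rw [← wordLength_inv hS]; exact_mod_cast wordLength_le_one h9
      refine ⟨l', h4, fun x => ?_, ?_⟩
      · rw [h5, h2, Set.Finite.mem_toFinset, mem_ofPred_eq]; omega
      · rw [h6]; push_cast; linarith
  obtain ⟨l, h1, h2, h3⟩ := hone n
  have hlen : l.length = ballCard S n := by
    rw [ballCard, ← List.toFinset_card_of_nodup h1, ← ncard_coe_finset]
    congr 1
    ext x
    simp [h2]
  have hpath : ∀ l : List G, pathLength (l.map (z * ·)) = pathLength l := by
    intro l
    induction l with
    | nil => rfl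
    | cons x l ih =>
      cases l with
      | nil => rfl
      | cons y l =>
        simp only [List.map_cons, pathLength_cons_cons] at ih ⊢
        rw [ih, hd, hd]
        congr 3
        group
  refine ⟨l.map (z * ·), h1.map (mul_right_injective z), fun x => ?_, by simpa using hlen, ?_⟩
  · rw [← h2, List.mem_map]
    refine ⟨?_, fun h => ⟨_, h, mul_inv_cancel_left z x⟩⟩
    rintro ⟨y, hy, rfl⟩
    simpa using hy
  · rw [hpath, List.length_map]; exact h3

end Balls

/-! ### Finite Assouad-Nagata dimension -/

section FiniteDimension

/-- A group with generating set `S` has linear growth. -/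
def HasLinearGrowth {G : Type*} [Group G] (S : Set G) : Prop :=
  ∃ C : ℕ, ∀ n, 1 ≤ n → ballCard S n ≤ C * n

/-- A maximal separated set is a net: a point far from all of it could be added. -/
theorem exists_separated_net {G : Type*} [Group G] {S : Set G} (hS : Subgroup.closure S = ⊤)
    (n : ℕ) : ∃ Z : Set G, (∀ z ∈ Z, ∀ w ∈ Z, z ≠ w → n < wordLength S (z⁻¹ * w)) ∧
      ∀ a, ∃ z ∈ Z, wordLength S (z⁻¹ * a) ≤ n := by
  obtain ⟨Z, hZ⟩ := zorn_subset {Z : Set G | Z.Pairwise fun z w => n < wordLength S (z⁻¹ * w)}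
    fun c hc hchain => ⟨⋃₀ c, (pairwise_sUnion hchain.directedOn).2 fun s hs => hc hs,
      fun s hs => subset_sUnion_of_mem hs⟩
  refine ⟨Z, fun z hz w hw h => hZ.prop hz hw h, fun a => ?_⟩
  by_contra! hfar
  have hins : (insert a Z).Pairwise fun z w => n < wordLength S (z⁻¹ * w) := by
    refine pairwise_insert.2 ⟨hZ.prop, fun z hz _ => ⟨?_, hfar z hz⟩⟩
    · rw [← wordLength_inv hS]; simpa using hfar z hz
  have := hfar a (hZ.le_of_ge hins (subset_insert a Z) (mem_insert a Z))
  simp [wordLength_one] at this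

/-- Doubling property of groups of linear growth. -/
theorem encard_net_le {G : Type*} [Group G] [Infinite G] {S : Set G}
    (hS : Subgroup.closure S = ⊤) (hfin : S.Finite) {C n : ℕ} (hn : 1 ≤ n)
    (hC : ∀ n, 1 ≤ n → ballCard S n ≤ C * n) {Z : Set G}
    (hZ : ∀ z ∈ Z, ∀ w ∈ Z, z ≠ w → n < wordLength S (z⁻¹ * w)) (a : G) :
    {z ∈ Z | wordLength S (z⁻¹ * a) ≤ 2 * n}.encard ≤ (6 * C : ℕ) := by
  classical
  have hball := finite_wordLength_le hS hfin
  have hfinite : {z ∈ Z | wordLength S (z⁻¹ * a) ≤ 2 * n}.Finite := by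
    refine ((hball (2 * n)).image fun x => a * x⁻¹).subset fun z hz => ⟨z⁻¹ * a, hz.2, ?_⟩
    simp
  set T := hfinite.toFinset with hT
  have hmemT : ∀ z ∈ T, z ∈ Z ∧ wordLength S (z⁻¹ * a) ≤ 2 * n := fun z hz => by
    simpa [hT] using hz
  rw [hfinite.encard_eq_coe_toFinset_card, ← hT, Nat.cast_le]
  set U := (hball (n / 2)).toFinset with hU
  have hmemU : ∀ u ∈ U, wordLength S u ≤ n / 2 := fun u hu => by simpa [hU] using hu
  have hUcard : n / 2 + 1 ≤ U.card := by
    rw [hU, ← ncard_eq_toFinset_card _ (hball _)]; exact succ_le_ballCard hS hfin _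
  have hVcard : (hball (3 * n)).toFinset.card ≤ C * (3 * n) := by
    rw [← ncard_eq_toFinset_card _ (hball _)]; exact hC _ (by omega)
  -- Balls of radius `n / 2` around the separated points are disjoint and lie in the ball of radius
  -- `3 * n` around `a`. Each has at least `n / 2 + 1` points, while linear growth bounds their
  -- union.
  have hle : (T ×ˢ U).card ≤ (hball (3 * n)).toFinset.card := by
    refine Finset.card_le_card_of_injOn (fun p => a⁻¹ * (p.1 * p.2)) ?_ ?_
    · rintro ⟨z, u⟩ hp
      obtain ⟨hz, hu⟩ := Finset.mem_product.1 hp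
      rw [Finset.mem_coe, Set.Finite.mem_toFinset, mem_ofPred_eq]
      have h1 := (hmemT z hz).2
      have h2 := hmemU u hu
      have h3 := wordLength_mul_le hS (a⁻¹ * z) u
      rw [← wordLength_inv hS] at h1
      simp only [mul_inv_rev, inv_inv] at h1
      have h4 : wordLength S (a⁻¹ * (z * u)) ≤ 3 * n := by
        rw [← mul_assoc]
        have h2' : wordLength S u ≤ n / 2 := h2
        omega
      exact h4
    · rintro ⟨z, u⟩ hp ⟨w, v⟩ hp' h
      obtain ⟨hz, hu⟩ := Finset.mem_product.1 hp
      obtain ⟨hw, hv⟩ := Finset.mem_product.1 hp'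
      have h1 : z * u = w * v := mul_left_cancel h
      have h2 : z⁻¹ * w = u * v⁻¹ := by
        rw [inv_mul_eq_iff_eq_mul, ← mul_assoc, h1]; simp
      have hzw : z = w := by
        by_contra hne
        have h3 := hZ z (hmemT z hz).1 w (hmemT w hw).1 hne
        have h4 := wordLength_mul_le hS u v⁻¹
        rw [wordLength_inv hS] at h4
        have h5 := hmemU u hu
        have h6 := hmemU v hv
        rw [h2] at h3
        have hu' : wordLength S u ≤ n / 2 := h5
        have hv' : wordLength S v ≤ n / 2 := h6
        omega
      subst hzw
      simpa using h1
  rw [Finset.card_product] at hle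
  have h1 : T.card * (n / 2 + 1) ≤ C * (3 * n) :=
    (Nat.mul_le_mul_left _ hUcard).trans (hle.trans hVcard)
  have h2 : n ≤ 2 * (n / 2 + 1) := by omega
  have h3 : T.card * (n / 2 + 1) ≤ (6 * C) * (n / 2 + 1) :=
    h1.trans (by nlinarith)
  exact Nat.le_of_mul_le_mul_right h3 (Nat.succ_pos _)

variable {A B : Type*} [Group A] [Group B] {S : Set (restrictedWreathProduct A B)}

/-- The cover consists of the sets `W z g` for `z` in an `n`-net of `A`: the base point is near `z`
and only the lamps within `Q` of `z` are free. Linear growth and finiteness of `B` make touring and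
resetting these lamps cost `O(n)`, which bounds the diameter. -/
theorem finiteANDim_of_hasLinearGrowth [Infinite A] [Finite B] [MetricSpace A]
    [MetricSpace (restrictedWreathProduct A B)] (hS : Subgroup.closure S = ⊤) (hfin : S.Finite)
    (hA : ∀ a b : A, dist a b = wordLength (baseGenerators S) (a⁻¹ * b))
    (hG : ∀ g h : restrictedWreathProduct A B, dist g h = wordLength S (g⁻¹ * h))
    (hgrowth : HasLinearGrowth (baseGenerators S)) :
    FiniteANDim (restrictedWreathProduct A B) := by
  have hSA := closure_baseGenerators hS
  have hfA := finite_baseGenerators hfin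
  obtain ⟨C, hC⟩ := hgrowth
  obtain ⟨D, hD⟩ := exists_wordLength_le_of_left_ne hS hfin
  obtain ⟨E, hE⟩ := exists_wordLength_le_path hS hfin hA
  obtain ⟨β, hβ⟩ := (finite_range (wordLength (lampGenerators S))).bddAbove
  have hβ : ∀ b, wordLength (lampGenerators S) b ≤ β := fun b => hβ ⟨b, rfl⟩
  set K : ℝ := E * (C * (D + 4) * β + 2 * (2 + (D + 4)) + 2 * (C * (D + 4))) + 1 with hK
  have hK0 : 0 < K := by positivity
  refine ⟨6 * C, K, hK0, fun r hr => ?_⟩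
  -- Distances are integers, so below scale `1` balls are points and singletons suffice.
  rcases lt_or_ge r 1 with hr1 | hr1
  · refine ⟨range fun g => {g}, ?_, ?_, fun g ρ hρ => ⟨{g}, ⟨g, rfl⟩, fun h hh => ?_⟩, fun g => ?_⟩
    · exact eq_univ_of_forall fun g => ⟨{g}, ⟨g, rfl⟩, rfl⟩
    · rintro _ ⟨g, rfl⟩ x rfl y rfl
      rw [dist_self]; positivity
    · have h1 := (Metric.mem_closedBall'.1 hh).trans_lt (hρ.trans_lt hr1)
      rw [hG] at h1
      have h2 : wordLength S (g⁻¹ * h) < 1 := by exact_mod_cast h1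
      exact (inv_mul_eq_one.1 (eq_one_of_wordLength_eq_zero hS (Nat.lt_one_iff.1 h2))).symm
    · refine (encard_le_encard (t := {{g}}) ?_).trans ((encard_singleton _).trans_le le_add_self)
      rintro _ ⟨⟨h, rfl⟩, hg⟩
      rw [mem_singleton_iff] at hg
      rw [hg]; rfl
  set n := ⌊r⌋₊ with hn
  have hn1 : 1 ≤ n := Nat.le_floor (by simpa using hr1)
  have hnr : (n : ℝ) ≤ r := Nat.floor_le hr.le
  obtain ⟨Z, hZ, hZnet⟩ := exists_separated_net hSA n
  -- Moving by at most `n` from a point based within `n` of `z` changes only lamps within `2 * n +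
  -- D` of `z`, and this is at most `Q` because `n ≥ 1`.
  set Q := (D + 4) * n with hQ
  have hDn : D + 4 * n ≤ Q := by rw [hQ, add_mul]; nlinarith
  let W : A → restrictedWreathProduct A B → Set (restrictedWreathProduct A B) := fun z g =>
    {h | wordLength (baseGenerators S) (z⁻¹ * h.1.right) ≤ 2 * n ∧
      ∀ x, Q < wordLength (baseGenerators S) (z⁻¹ * x) → h.1.left x = g.1.left x}
  have htri : ∀ z a b : A, wordLength (baseGenerators S) (z⁻¹ * b) ≤
      wordLength (baseGenerators S) (z⁻¹ * a) + wordLength (baseGenerators S) (a⁻¹ * b) :=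
    fun z a b => by
      have := wordLength_mul_le hSA (z⁻¹ * a) (a⁻¹ * b)
      rwa [show z⁻¹ * a * (a⁻¹ * b) = z⁻¹ * b by group] at this
  have hball : ∀ g, ∀ ρ ≤ r, ∃ V ∈ {V | ∃ z ∈ Z, ∃ g, V = W z g}, Metric.closedBall g ρ ⊆ V := by
    intro g ρ hρ
    obtain ⟨z, hz, hzg⟩ := hZnet g.1.right
    refine ⟨W z g, ⟨z, hz, g, rfl⟩, fun h hh => ?_⟩
    have h1 : wordLength S (g⁻¹ * h) ≤ n := by
      have := (Metric.mem_closedBall'.1 hh).trans hρ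
      rw [hG] at this
      exact Nat.le_floor this
    refine ⟨?_, fun x hx => ?_⟩
    · have h2 := wordLength_right_le hS g h
      have h3 := htri z g.1.right h.1.right
      omega
    · by_contra hne
      have h2 := hD g h x (Ne.symm hne)
      have h3 := htri z g.1.right x
      omega
  refine ⟨{V | ∃ z ∈ Z, ∃ g, V = W z g}, ?_, ?_, hball, fun g => ?_⟩
  · refine eq_univ_of_forall fun g => ?_
    obtain ⟨V, hV, hgV⟩ := hball g r le_rfl
    exact ⟨V, hV, hgV (Metric.mem_closedBall_self hr.le)⟩
  · rintro _ ⟨z, hz, g, rfl⟩ h ⟨h1, h2⟩ h' ⟨h1', h2'⟩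
    obtain ⟨l, -, hl, hlen, hpath⟩ := exists_enumeration_ball hSA hfA hA z Q
    have h3 := hE l h h' fun x hx => by
      have hx : Q < wordLength (baseGenerators S) (z⁻¹ * x) := not_le.1 fun h => hx ((hl x).2 h)
      rw [h2 x hx, h2' x hx]
    have hlenC : (l.length : ℝ) ≤ C * (D + 4) * n := by
      rw [hlen]
      have := hC Q (by omega)
      rw [hQ, ← mul_assoc] at this
      exact_mod_cast this
    have hsum : (l.map fun x =>
        (wordLength (lampGenerators S) ((h.1.left x)⁻¹ * h'.1.left x) : ℝ)).sum ≤
        l.length * β := by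
      have := List.sum_le_card_nsmul (l.map fun x =>
        (wordLength (lampGenerators S) ((h.1.left x)⁻¹ * h'.1.left x) : ℝ)) (β : ℝ) (by
          simp only [List.mem_map]
          rintro _ ⟨x, -, rfl⟩
          exact_mod_cast hβ _)
      simpa using this
    have hend : ∀ y, wordLength (baseGenerators S) (z⁻¹ * y) ≤ 2 * n → ∀ x ∈ l,
        dist x y ≤ (2 + (D + 4)) * n := fun y hy x hx => by
      have h4 := (hl x).1 hx
      have h5 := dist_triangle_left x y z
      rw [hA z, hA z] at h5
      have h6 : wordLength (baseGenerators S) (z⁻¹ * x) +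
          wordLength (baseGenerators S) (z⁻¹ * y) ≤ (2 + (D + 4)) * n := by
        rw [add_mul, ← hQ]; omega
      have h7 : ((wordLength (baseGenerators S) (z⁻¹ * x) : ℝ) +
          wordLength (baseGenerators S) (z⁻¹ * y)) ≤ (2 + (D + 4)) * n := by exact_mod_cast h6
      linarith
    have hz : z ∈ l := (hl z).2 (by simp [wordLength_one])
    have hpl : pathLength (h.1.right :: (l ++ [h'.1.right])) ≤
        2 * ((2 + (D + 4)) * n) + 2 * l.length := by
      have h4 := pathLength_append_le (l₁ := l) (l₂ := [h'.1.right])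
        (D := (2 + (D + 4)) * n) (by positivity) (by simpa using hend _ h1')
      cases l with
      | nil => simp at hz
      | cons x l =>
        rw [List.cons_append, pathLength_cons_cons]
        rw [List.cons_append, pathLength_singleton] at h4
        have h5 := hend _ h1 x (by simp)
        rw [dist_comm] at h5
        linarith
    rw [hG]
    have hE0 : (0 : ℝ) ≤ E := Nat.cast_nonneg E
    have hβ0 : (0 : ℝ) ≤ β := Nat.cast_nonneg β
    calc (wordLength S (h⁻¹ * h') : ℝ) ≤ _ := h3
      _ ≤ E * (C * (D + 4) * n * β + (2 * ((2 + (D + 4)) * n) + 2 * (C * (D + 4) * n))) := by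
          refine mul_le_mul_of_nonneg_left (add_le_add ?_ ?_) hE0
          · exact hsum.trans (mul_le_mul_of_nonneg_right hlenC hβ0)
          · exact hpl.trans (by linarith)
      _ = (K - 1) * n := by rw [hK]; ring
      _ ≤ K * n := by nlinarith [Nat.cast_nonneg (α := ℝ) n]
      _ ≤ K * r := by gcongr
  -- A member of the cover containing `g` equals `W z g`, so it is determined by `z`, and the
  -- doubling bound counts the possible `z`.
  · calc _ ≤ ((fun z => W z g) ''
          {z ∈ Z | wordLength (baseGenerators S) (z⁻¹ * g.1.right) ≤ 2 * n}).encard := by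
          refine encard_le_encard ?_
          rintro _ ⟨⟨z, hz, g', rfl⟩, hg1, hg2⟩
          refine ⟨z, ⟨hz, hg1⟩, ?_⟩
          ext h
          refine and_congr_right fun _ => forall₂_congr fun x hx => ?_
          rw [hg2 x hx]
      _ ≤ _ := encard_image_le _ _
      _ ≤ (6 * C : ℕ) := encard_net_le hSA hfA hn1 hC hZ _
      _ ≤ _ := le_self_add

end FiniteDimension

/-! ### Cubes in wreath products -/

section Cubes

/-! ### Cutting paths into short blocks of equal cardinality -/

section Blocks

variable {M : Type*} [MetricSpace M]

theorem pathLength_add_le_append (l₁ l₂ : List M) :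
    pathLength l₁ + pathLength l₂ ≤ pathLength (l₁ ++ l₂) := by
  induction l₁ with
  | nil => simp [pathLength]
  | cons x l ih =>
    cases l with
    | nil => simpa [pathLength_singleton] using pathLength_le_cons x l₂
    | cons y l =>
      simp only [List.cons_append, pathLength_cons_cons] at ih ⊢
      linarith

theorem pathLength_closed_le {z : M} {ρ : ℝ} (hρ : 0 ≤ ρ) {l : List M}
    (h : ∀ x ∈ l, dist z x ≤ ρ) : pathLength (z :: (l ++ [z])) ≤ 2 * ρ + pathLength l := by
  have h1 := pathLength_append_le (l₁ := [z]) (l₂ := l ++ [z]) hρ (by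
    simp only [List.mem_singleton, List.mem_append]
    rintro x rfl y (hy | rfl)
    · exact h y hy
    · rwa [dist_self])
  have h2 := pathLength_append_le (l₁ := l) (l₂ := [z]) hρ (by
    simp only [List.mem_singleton]
    rintro x hx y rfl
    rw [dist_comm]; exact h x hx)
  rw [pathLength_singleton] at h1 h2
  simp only [List.cons_append, List.nil_append] at h1
  linarith

/-- A short path can be cut so that it contains many short blocks of a given cardinality. -/
theorem exists_blocks {r : ℕ} (hr : 1 ≤ r) (m : ℕ) : ∀ (N : ℕ) (l : List M), l.length ≤ m →
    8 * r * N + pathLength l + 8 * r ≤ 8 * l.length →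
    ∃ P : List (List M), P.length = N ∧ P.flatten.Sublist l ∧
      ∀ b ∈ P, b.length = r ∧ pathLength b ≤ 8 * r := by
  have hr' : (1 : ℝ) ≤ r := by exact_mod_cast hr
  induction m with
  | zero =>
    intro N l hl h
    have h0 := pathLength_nonneg l
    have h1 : (l.length : ℝ) ≤ 0 := by exact_mod_cast hl
    have h2 : (0 : ℝ) ≤ 8 * r * N := by positivity
    linarith
  | succ m ih =>
    intro N l hl h
    cases N with
    | zero => exact ⟨[], rfl, by simp, by simp⟩
    | succ N =>
      have h0 := pathLength_nonneg l
      have hle : r ≤ l.length := by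
        have h2 : (0 : ℝ) ≤ 8 * r * (N + 1 : ℕ) := by positivity
        have : (r : ℝ) ≤ l.length := by linarith
        exact_mod_cast this
      have hsplit := pathLength_add_le_append (l.take r) (l.drop r)
      rw [List.take_append_drop] at hsplit
      have hdrop : (l.drop r).length + r = l.length := by rw [List.length_drop]; omega
      have hdrop' : ((l.drop r).length : ℝ) + r = l.length := by exact_mod_cast hdrop
      have htake := pathLength_nonneg (l.take r)
      -- Keeping a block lowers `8 * r * N` by `8 * r`; discarding one lowers the path length by
      -- more than `8 * r`. Either way the inequality survives the loss of `r` points.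
      by_cases hb : pathLength (l.take r) ≤ 8 * r
      · obtain ⟨P, h1, h2, h3⟩ := ih N (l.drop r) (by omega) (by push_cast at h; linarith)
        refine ⟨l.take r :: P, by simp [h1], ?_, ?_⟩
        · have := (List.Sublist.refl (l.take r)).append h2
          rwa [List.take_append_drop] at this
        · intro b hbP
          rcases List.mem_cons.1 hbP with rfl | hbP
          · exact ⟨by simp [hle], hb⟩
          · exact h3 b hbP
      · obtain ⟨P, h1, h2, h3⟩ := ih (N + 1) (l.drop r) (by omega) (by linarith)
        exact ⟨P, h1, h2.trans (List.drop_sublist r l), h3⟩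

end Blocks

/-- If `B` is infinite or the growth of `A` is not linear, there are arbitrarily many disjoint sets
of lamps that can be switched independently at comparable costs. -/
theorem exists_lamp_blocks {A B : Type*} [Group A] [Group B] [Infinite A] [Nontrivial B]
    [MetricSpace A] {SA : Set A} {SB : Set B} (hSA : Subgroup.closure SA = ⊤) (hfA : SA.Finite)
    (hSB : Subgroup.closure SB = ⊤) (hfB : SB.Finite)
    (hA : ∀ a b : A, dist a b = wordLength SA (a⁻¹ * b))
    (h : ¬ (Finite B ∧ HasLinearGrowth SA)) (N : ℕ) :
    ∃ (w : ℕ) (b : B) (l : ℕ → List A), 0 < w ∧ (∀ i < N, (l i).Nodup) ∧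
      (∀ i < N, ∀ j < N, i ≠ j → ∀ x ∈ l i, x ∉ l j) ∧
      (∀ i < N, (l i).length * wordLength SB b = w) ∧ wordLength SB b ≤ w ∧
      ∀ i < N, pathLength (1 :: (l i ++ [1])) ≤ 10 * w := by
  have hone : ∀ x : A, dist 1 x = wordLength SA x := fun x => by rw [hA]; simp
  rcases finite_or_infinite B with hB | hB
  · have hgr : ¬ HasLinearGrowth SA := fun hg => h ⟨hB, hg⟩
    simp only [HasLinearGrowth, not_exists, not_forall, not_le] at hgr
    -- The `r`-ball has more than `2 (N + 1) r` points and a tour of at most twice that many steps,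
    -- enough for `N` short blocks of `r` lamps. Joining a block to `1` at both ends adds `2 r`.
    obtain ⟨r, hr, hlt⟩ := hgr (2 * (N + 1))
    obtain ⟨l, hnd, hmem, hlen, hpath⟩ := exists_enumeration_ball hSA hfA hA 1 r
    rw [← hlen] at hlt
    have hlt' : (2 * (N + 1) * r : ℝ) ≤ l.length := by exact_mod_cast hlt.le
    obtain ⟨P, hPN, hsub, hP⟩ := exists_blocks hr l.length N l le_rfl (by linarith)
    obtain ⟨b, hb⟩ := exists_ne (1 : B)
    have hb1 := wordLength_pos hSB hb
    have hget : ∀ i (hi : i < N), P.getD i [] = P[i]'(hPN ▸ hi) := fun i hi =>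
      List.getD_eq_getElem _ _ _
    have hgetmem : ∀ i < N, P.getD i [] ∈ P := fun i hi => by
      rw [hget i hi]; exact List.getElem_mem _
    obtain ⟨hnd1, hnd2⟩ := List.nodup_flatten.1 (hsub.nodup hnd)
    rw [List.pairwise_iff_getElem] at hnd2
    have hrw : (r : ℝ) ≤ (r * wordLength SB b : ℕ) := by
      exact_mod_cast Nat.le_mul_of_pos_right r hb1
    refine ⟨r * wordLength SB b, b, fun i => P.getD i [], Nat.mul_pos hr hb1,
      fun i hi => hnd1 _ (hgetmem i hi), fun i hi j hj hij x hx hx' => ?_, fun i hi => ?_,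
      Nat.le_mul_of_pos_left _ hr, fun i hi => ?_⟩
    · simp only [hget i hi, hget j hj] at hx hx'
      rcases lt_or_gt_of_ne hij with hlt | hlt
      · exact hnd2 i j _ _ hlt hx hx'
      · exact hnd2 j i _ _ hlt hx' hx
    · rw [(hP _ (hgetmem i hi)).1]
    · have h1 := pathLength_closed_le (z := (1 : A)) (ρ := r) (Nat.cast_nonneg r)
        (l := P.getD i []) fun x hx => by
          have h2 : x ∈ l := hsub.subset (List.mem_flatten.2 ⟨_, hgetmem i hi, hx⟩)
          rw [hone]
          have := (hmem x).1 h2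
          rw [inv_one, one_mul] at this
          exact_mod_cast this
      have h2 := (hP _ (hgetmem i hi)).2
      linarith
  · let p : ℕ → A := Infinite.natEmbedding A
    have hp : Function.Injective p := (Infinite.natEmbedding A).injective
    -- With `B` infinite, blocks are single lamps, and `b` is so long that switching one costs at
    -- least as much as walking to any of them.
    set ρ := (∑ i ∈ Finset.range N, wordLength SA (p i)) + 1 with hρ
    obtain ⟨b, hb⟩ := exists_wordLength_eq hSB hfB ρ
    refine ⟨ρ, b, fun i => [p i], Nat.succ_pos _, fun i _ => List.nodup_singleton _,
      fun i _ j _ hij x hx hx' => ?_, fun i _ => by simp [hb], hb.le, fun i hi => ?_⟩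
    · rw [List.mem_singleton] at hx hx'
      exact hij (hp (hx.symm.trans hx'))
    · have h1 : wordLength SA (p i) ≤ ρ :=
        (Finset.single_le_sum (f := fun i => wordLength SA (p i)) (fun _ _ => Nat.zero_le _)
          (Finset.mem_range.2 hi)).trans (Nat.le_succ _)
      have h2 := pathLength_closed_le (z := (1 : A)) (ρ := ρ) (Nat.cast_nonneg ρ) (l := [p i])
        fun x hx => by
          rw [List.mem_singleton] at hx
          rw [hx, hone]; exact_mod_cast h1
      rw [pathLength_singleton] at h2
      have : (0 : ℝ) ≤ ρ := Nat.cast_nonneg ρ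
      linarith

/-- Indexing blocks by `x i * q + i` gives each pair of a value and a coordinate its own block. -/
theorem mul_add_injective {q a a' i i' : ℕ} (hi : i < q) (hi' : i' < q)
    (h : a * q + i = a' * q + i') : a = a' ∧ i = i' := by
  have hq : 0 < q := by omega
  rw [Nat.add_comm, Nat.add_comm (a' * q)] at h
  have h1 := congrArg (· / q) h
  simp only [Nat.add_mul_div_right _ _ hq, Nat.div_eq_of_lt hi, Nat.div_eq_of_lt hi',
    zero_add] at h1
  subst h1
  exact ⟨rfl, Nat.add_right_cancel h⟩

open scoped Classical in
/-- The element of the wreath product whose lamps at the points of `l (x i * q + i)`, `i < q`, have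
state `b`, all others being off. -/
noncomputable def cubePoint {A B : Type*} [Group A] [Group B] (b : B) (l : ℕ → List A) {q : ℕ}
    (x : Fin q → ℕ) : restrictedWreathProduct A B :=
  ⟨⟨fun p => if ∃ i, p ∈ l (x i * q + i) then b else 1, 1⟩, by
    refine (finite_iUnion fun i : Fin q => (l (x i * q + i)).finite_toSet).subset fun p hp => ?_
    rw [Function.mem_mulSupport] at hp
    rw [mem_iUnion]
    by_contra hne
    exact hp (if_neg hne)⟩

variable {A B : Type*} [Group A] [Group B] {S : Set (restrictedWreathProduct A B)}

theorem cubePoint_left_of_mem {b : B} {l : ℕ → List A} {q : ℕ} {x : Fin q → ℕ} {p : A} {i : Fin q}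
    (h : p ∈ l (x i * q + i)) : (cubePoint b l x).1.left p = b :=
  if_pos ⟨i, h⟩

theorem cubePoint_left_of_forall_notMem {b : B} {l : ℕ → List A} {q : ℕ} {x : Fin q → ℕ} {p : A}
    (h : ∀ i : Fin q, p ∉ l (x i * q + i)) : (cubePoint b l x).1.left p = 1 :=
  if_neg fun ⟨i, hi⟩ => h i hi

/-- Changing one coordinate switches one block off and another on. If all coordinates differ, the
`q` blocks lit for `x` are all dark for `y`, which forces lamp variation at least `q * w`. -/
theorem hasCubes [Infinite A] [Nontrivial B] [MetricSpace A]
    [MetricSpace (restrictedWreathProduct A B)] (hS : Subgroup.closure S = ⊤) (hfin : S.Finite)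
    (hA : ∀ a b : A, dist a b = wordLength (baseGenerators S) (a⁻¹ * b))
    (hG : ∀ g h : restrictedWreathProduct A B, dist g h = wordLength S (g⁻¹ * h))
    (h : ¬ (Finite B ∧ HasLinearGrowth (baseGenerators S))) :
    HasCubes (restrictedWreathProduct A B) := by
  classical
  have hSB := closure_lampGenerators hS
  obtain ⟨F, hF⟩ := exists_sum_wordLength_left_le hS hfin
  obtain ⟨E, hE⟩ := exists_wordLength_le_path hS hfin hA
  refine ⟨23 * E * (F + 1), fun q n => ?_⟩
  obtain ⟨w, b, l, hw, hnd, hdisj, hcard, hbw, hpath⟩ := exists_lamp_blocks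
    (closure_baseGenerators hS) (finite_baseGenerators hfin) hSB (finite_lampGenerators hfin)
    hA h (n * q)
  have hw' : (0 : ℝ) < w := by exact_mod_cast hw
  have hidx : ∀ x : Fin q → ℕ, (∀ i, x i < n) → ∀ i : Fin q, x i * q + i < n * q := by
    intro x hx i
    calc x i * q + i < x i * q + q := Nat.add_lt_add_left i.2 _
      _ = (x i + 1) * q := by ring
      _ ≤ n * q := Nat.mul_le_mul_right q (hx i)
  -- The factor `F + 1` absorbs the Lipschitz constant `F` and stays positive if `F = 0`. The
  -- constant `23` consists of `3` for the lamps and `20` for two closed tours of length at most `10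
  -- * w`.
  refine ⟨w / (F + 1), by positivity, cubePoint b l, fun x y hx hy => ⟨fun hxy => ?_, fun hxy => ?_⟩⟩
  · rw [hG]
    have hC : 23 * (E : ℝ) * (F + 1) * (w / (F + 1)) = E * (3 * w + 20 * w) := by
      field_simp; ring
    rw [hC]
    by_cases heq : x = y
    · rw [heq, inv_mul_cancel, wordLength_one]
      simp only [Nat.cast_zero]; positivity
    obtain ⟨i, hi⟩ := Function.ne_iff.1 heq
    have hother : ∀ j, j ≠ i → x j = y j := fun j hj => by
      by_contra hne
      exact hj (hxy hne hi)
    -- The `1` in the middle splits the walk into two closed tours based at `1`; counting it as a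
    -- lamp costs at most one further `w`.
    have h1 := hE (l (x i * q + i) ++ 1 :: l (y i * q + i)) (cubePoint b l x) (cubePoint b l y)
      fun p hp => by
        simp only [List.mem_append, List.mem_cons, not_or] at hp
        obtain ⟨hp1, -, hp2⟩ := hp
        by_cases hex : ∃ j : Fin q, p ∈ l (x j * q + j)
        · obtain ⟨j, hj⟩ := hex
          have hji : j ≠ i := fun h => hp1 (h ▸ hj)
          rw [cubePoint_left_of_mem hj]
          rw [hother j hji] at hj
          rw [cubePoint_left_of_mem hj]
        · have hex' : ∀ j : Fin q, p ∉ l (y j * q + j) := fun j hj => by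
            by_cases hji : j = i
            · exact hp2 (hji ▸ hj)
            · rw [← hother j hji] at hj
              exact hex ⟨j, hj⟩
          rw [cubePoint_left_of_forall_notMem (not_exists.1 hex),
            cubePoint_left_of_forall_notMem hex']
    refine h1.trans (mul_le_mul_of_nonneg_left (add_le_add ?_ ?_) (Nat.cast_nonneg E))
    · have hterm : ∀ p, wordLength (lampGenerators S)
          (((cubePoint b l x).1.left p)⁻¹ * (cubePoint b l y).1.left p) ≤
          wordLength (lampGenerators S) b := by
        have hv : ∀ x : Fin q → ℕ, ∀ p, (cubePoint b l x).1.left p = b ∨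
            (cubePoint b l x).1.left p = 1 := fun x p => ite_eq_or_eq _ _ _
        intro p
        rcases hv x p with h1 | h1 <;> rcases hv y p with h2 | h2 <;>
          simp [h1, h2, wordLength_one, wordLength_inv hSB]
      have h2 := List.sum_le_card_nsmul ((l (x i * q + i) ++ 1 :: l (y i * q + i)).map fun p =>
        (wordLength (lampGenerators S)
          (((cubePoint b l x).1.left p)⁻¹ * (cubePoint b l y).1.left p) : ℝ))
        (wordLength (lampGenerators S) b : ℝ) (by
          simp only [List.mem_map]
          rintro _ ⟨p, -, rfl⟩
          exact_mod_cast hterm p)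
      refine h2.trans ?_
      have h3 := hcard _ (hidx x hx i)
      have h4 := hcard _ (hidx y hy i)
      rw [nsmul_eq_mul, List.length_map, List.length_append, List.length_cons]
      have h5 : ((l (x i * q + i)).length + ((l (y i * q + i)).length + 1)) *
          wordLength (lampGenerators S) b ≤ 3 * w := by
        rw [add_mul, add_mul, h3, h4]; omega
      exact_mod_cast h5
    · have h2 := hpath _ (hidx x hx i)
      have h3 := hpath _ (hidx y hy i)
      have h4 : pathLength ((cubePoint b l x).1.right ::
          ((l (x i * q + i) ++ 1 :: l (y i * q + i)) ++ [(cubePoint b l y).1.right])) =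
          pathLength (1 :: (l (x i * q + i) ++ [1])) +
            pathLength (1 :: (l (y i * q + i) ++ [1])) := by
        have := pathLength_append_cons (1 :: l (x i * q + i)) 1 (l (y i * q + i) ++ [1])
        rw [List.append_assoc]
        exact this
      rw [h4]
      linarith
  · have h1 := hF (Finset.univ.biUnion fun i : Fin q => (l (x i * q + i)).toFinset)
      (cubePoint b l x) (cubePoint b l y)
    have h2 : ∀ i : Fin q, ∀ p ∈ (l (x i * q + i)).toFinset, wordLength (lampGenerators S)
        (((cubePoint b l x).1.left p)⁻¹ * (cubePoint b l y).1.left p) =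
        wordLength (lampGenerators S) b := by
      intro i p hp
      rw [List.mem_toFinset] at hp
      rw [cubePoint_left_of_mem hp, cubePoint_left_of_forall_notMem fun j => ?_, mul_one,
        wordLength_inv hSB]
      refine hdisj _ (hidx x hx i) _ (hidx y hy j) (fun he => ?_) p hp
      obtain ⟨h3, h4⟩ := mul_add_injective i.2 j.2 he
      obtain rfl := Fin.ext h4
      exact hxy i h3
    rw [Finset.sum_biUnion, Finset.sum_congr rfl fun i _ => Finset.sum_congr rfl (h2 i)] at h1
    · simp only [Finset.sum_const, smul_eq_mul] at h1
      have h3 : ∀ i : Fin q, (l (x i * q + i)).toFinset.card * wordLength (lampGenerators S) b = w :=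
        fun i => by
          rw [List.toFinset_card_of_nodup (hnd _ (hidx x hx i)), hcard _ (hidx x hx i)]
      rw [Finset.sum_congr rfl fun i _ => h3 i, Finset.sum_const, Finset.card_univ,
        Fintype.card_fin, smul_eq_mul] at h1
      rw [hG, ← mul_div_assoc, div_le_iff₀ (by positivity)]
      have h4 : q * w ≤ wordLength S ((cubePoint b l x)⁻¹ * cubePoint b l y) * (F + 1) :=
        h1.trans (by rw [mul_comm]; exact Nat.mul_le_mul_left _ (Nat.le_succ F))
      exact_mod_cast h4
    · intro i _ j _ hij
      rw [Function.onFun, Finset.disjoint_left]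
      intro p hp hp'
      rw [List.mem_toFinset] at hp hp'
      refine hdisj _ (hidx x hx i) _ (hidx x hx j) (fun he => hij ?_) p hp hp'
      exact Fin.ext (mul_add_injective i.2 j.2 he).2

end Cubes

/-! ### The main theorem -/

section Breakpoint

variable {M : Type*} [MetricSpace M]

theorem orderBreakpoint_eq_top_iff [Nontrivial M] (T : LinearOrder M) :
    orderBreakpoint T = ⊤ ↔ ∀ k : ℕ, 1 ≤ k → orderRatio T k = k := by
  rw [orderBreakpoint, if_neg (not_subsingleton M), sInf_eq_top]
  constructor
  · intro h k hk
    refine le_antisymm (orderRatio_le T k) (not_lt.1 fun hlt => ?_)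
    exact ENat.natCast_ne_top k (h k ⟨k, rfl, hk, hlt⟩)
  · rintro h _ ⟨k, -, hk, hlt⟩
    exact absurd (h k hk) hlt.ne

theorem spaceOrderRatio_eq_of_forall {k : ℕ} {a : ℝ}
    (h : ∀ T : LinearOrder M, orderRatio T k = a) : spaceOrderRatio M k = a := by
  classical
  have : Nonempty (LinearOrder M) := ⟨linearOrderOfSTO WellOrderingRel⟩
  simp only [spaceOrderRatio, h]
  exact ciInf_const

theorem spaceOrderRatio_le (T : LinearOrder M) (k : ℕ) : spaceOrderRatio M k ≤ orderRatio T k :=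
  ciInf_le ⟨0, by rintro _ ⟨T, rfl⟩; exact orderRatio_nonneg T k⟩ T

end Breakpoint

theorem exists_mul_log_lt (C : ℝ) : ∃ k : ℕ, 2 ≤ k ∧ C * Real.log k < k := by
  have h1 := (Real.isLittleO_log_id_atTop.comp_tendsto
    (tendsto_natCast_atTop_atTop (R := ℝ))).def
    (show 0 < 1 / (2 * (|C| + 1)) by positivity)
  obtain ⟨k, hk, hk2⟩ := (h1.and (Filter.eventually_ge_atTop 2)).exists
  refine ⟨k, hk2, ?_⟩
  have hkR : (2 : ℝ) ≤ k := by exact_mod_cast hk2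
  have hlog : 0 ≤ Real.log k := Real.log_nonneg (by linarith)
  simp only [Function.comp_apply, id, Real.norm_eq_abs, abs_of_nonneg hlog,
    abs_of_nonneg (show (0 : ℝ) ≤ k by linarith)] at hk
  calc C * Real.log k ≤ (|C| + 1) * Real.log k := by
        gcongr
        linarith [le_abs_self C]
    _ ≤ (|C| + 1) * (1 / (2 * (|C| + 1)) * k) := by gcongr
    _ = k / 2 := by field_simp
    _ < k := by linarith

theorem mainTheorem8 {A B : Type*} [Group A] [Group B] [Infinite A] [Nontrivial B]
    (S : Set (restrictedWreathProduct A B)) (hfin : S.Finite)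
    (hS : Subgroup.closure S = ⊤) :
    letI : MetricSpace (restrictedWreathProduct A B) := wordMetricSpace S hS
    -- exactly one of the two alternatives holds
    Xor
      (∃ T : LinearOrder (restrictedWreathProduct A B), ∃ C : ℝ, 0 < C ∧
        ∀ k : ℕ, 2 ≤ k → orderRatio T k ≤ C * Real.log k)
      (∀ T : LinearOrder (restrictedWreathProduct A B), orderBreakpoint T = ⊤) ∧
    -- the first one holds exactly when the Assouad-Nagata dimension is finite
    ((∃ T : LinearOrder (restrictedWreathProduct A B), ∃ C : ℝ, 0 < C ∧
        ∀ k : ℕ, 2 ≤ k → orderRatio T k ≤ C * Real.log k) ↔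
      FiniteANDim (restrictedWreathProduct A B)) ∧
    ((∃ C : ℝ, 0 < C ∧ ∀ k : ℕ, 2 ≤ k →
        spaceOrderRatio (restrictedWreathProduct A B) k ≤ C * Real.log k) ↔
      FiniteANDim (restrictedWreathProduct A B)) ∧
    -- in the second one all order ratio functions are linear
    ((∀ T : LinearOrder (restrictedWreathProduct A B), orderBreakpoint T = ⊤) →
      (∀ T : LinearOrder (restrictedWreathProduct A B), ∀ k : ℕ, 1 ≤ k → orderRatio T k = k) ∧
      ∀ k : ℕ, 1 ≤ k → spaceOrderRatio (restrictedWreathProduct A B) k = k) := by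
  let mG : MetricSpace (restrictedWreathProduct A B) := wordMetricSpace S hS
  let mA : MetricSpace A := wordMetricSpace (baseGenerators S) (closure_baseGenerators hS)
  have hA : ∀ a b : A, dist a b = wordLength (baseGenerators S) (a⁻¹ * b) := fun _ _ => rfl
  have hG : ∀ g h : restrictedWreathProduct A B, dist g h = wordLength S (g⁻¹ * h) :=
    fun _ _ => rfl
  have : Nontrivial (restrictedWreathProduct A B) := by
    obtain ⟨a, ha⟩ := exists_ne (1 : A)
    exact ⟨baseHom A B a, 1, fun h => ha (congrArg (fun g => g.1.right) h)⟩
  have hdisc : ∀ g h : restrictedWreathProduct A B, g ≠ h → 1 ≤ dist g h := fun g h hne => by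
    rw [hG]
    exact_mod_cast wordLength_pos hS fun he => hne (inv_mul_eq_one.1 he)
  have hlast : (∀ T : LinearOrder (restrictedWreathProduct A B), orderBreakpoint T = ⊤) →
      (∀ T : LinearOrder (restrictedWreathProduct A B), ∀ k : ℕ, 1 ≤ k → orderRatio T k = k) ∧
      ∀ k : ℕ, 1 ≤ k → spaceOrderRatio (restrictedWreathProduct A B) k = k := fun h =>
    ⟨fun T => (orderBreakpoint_eq_top_iff T).1 (h T), fun k hk =>
      spaceOrderRatio_eq_of_forall fun T => (orderBreakpoint_eq_top_iff T).1 (h T) k hk⟩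
  have hlog_of_dim : FiniteANDim (restrictedWreathProduct A B) →
      ∃ T : LinearOrder (restrictedWreathProduct A B), ∃ C : ℝ, 0 < C ∧
        ∀ k : ℕ, 2 ≤ k → orderRatio T k ≤ C * Real.log k :=
    FiniteANDim.exists_orderRatio_le_log hdisc
  have hspace_of_log : (∃ T : LinearOrder (restrictedWreathProduct A B), ∃ C : ℝ, 0 < C ∧
        ∀ k : ℕ, 2 ≤ k → orderRatio T k ≤ C * Real.log k) →
      ∃ C : ℝ, 0 < C ∧ ∀ k : ℕ, 2 ≤ k →
        spaceOrderRatio (restrictedWreathProduct A B) k ≤ C * Real.log k := by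
    rintro ⟨T, C, hC, hT⟩
    exact ⟨C, hC, fun k hk => (spaceOrderRatio_le T k).trans (hT k hk)⟩
  -- Linear order ratios even rule out a logarithmic bound in which the order may vary with `k`.
  have hnot : (∀ T : LinearOrder (restrictedWreathProduct A B), orderBreakpoint T = ⊤) →
      ¬ ∃ C : ℝ, 0 < C ∧ ∀ k : ℕ, 2 ≤ k →
        spaceOrderRatio (restrictedWreathProduct A B) k ≤ C * Real.log k := by
    rintro htop ⟨C, -, hC⟩
    obtain ⟨k, hk, hlt⟩ := exists_mul_log_lt C
    have h1 := hC k hk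
    rw [(hlast htop).2 k (by omega)] at h1
    exact absurd hlt h1.not_gt
  -- The algebraic dichotomy, finite `B` with linear growth of `A` or not, decides between the two
  -- alternatives.
  have hdich : FiniteANDim (restrictedWreathProduct A B) ∨
      ∀ T : LinearOrder (restrictedWreathProduct A B), orderBreakpoint T = ⊤ := by
    by_cases hlin : Finite B ∧ HasLinearGrowth (baseGenerators S)
    · have := hlin.1
      exact Or.inl (finiteANDim_of_hasLinearGrowth hS hfin hA hG hlin.2)
    · exact Or.inr fun T => (orderBreakpoint_eq_top_iff T).2 fun k hk =>
        (hasCubes hS hfin hA hG hlin).orderRatio_eq T hk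
  refine ⟨?_, ⟨fun h => ?_, hlog_of_dim⟩, ⟨fun h => ?_, fun h => hspace_of_log (hlog_of_dim h)⟩,
    hlast⟩
  · rcases hdich with h | h
    · exact Or.inl ⟨hlog_of_dim h, fun htop => hnot htop (hspace_of_log (hlog_of_dim h))⟩
    · exact Or.inr ⟨h, fun hlog => hnot h (hspace_of_log hlog)⟩
  · exact hdich.resolve_right fun htop => hnot htop (hspace_of_log h)
  · exact hdich.resolve_right fun htop => hnot htop h
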